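/- Let $k$ be a commutative ring, $H$ a Hopf algebra over $k$ with antipode $S$ and counit $\varepsilon$, and $A$ a left $H$-module algebra. Assume that $A$ is $H$-semiprime, i.e. $A$ has no nonzero $H$-stable two-sided ideal $K$ with $K^2=0$, and that at least one of the following holds: (i) $A$ is commutative; (ii) $A$ is semiprime (no nonzero two-sided ideal of square zero); (iii) $S$ is bijective. Notation. Let $A^e\#_\nu H$ be the $k$-module $(A\otimes A^{op})\otimes H$ with product $$((a\otimes b)\# h)((a'\otimes b')\# g)=\sum \big(a(h_1\cdot a')\otimes (h_3\cdot b')b\big)\# h_2g ;$$ $A$ is a left module over it via $((a\otimes b)\# h)\cdot x=a(h\cdot x)b$. Let $E$ be an injective hull of $A$ as an $A^e\#_\nu H$-module and $\widehat A=\sum_{f\in \mathrm{Hom}(A,E)}\mathrm{Im} f\subseteq E$ the self-injective hull of $A$. Let $T$ be the endomorphism ring of the $A^e\#_\nu H$-module $\widehat A$; write $as:=s(a)$ for $a\in A$, $s\in T$. Let $\mathcal F_H$ be the set of $H$-stable two-sided ideals of $A$ with zero left and zero right annihilator, and let $Q_0$ be the right Martindale quotient ring, whose elements are the classes $[f:I\to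 A]$ of right $A$-linear maps with $I\in\mathcal F_H$, two maps being identified if they agree on some member of $\mathcal F_H$; for $f:I\to A$ and $g:J\to A$, $[f]+[g]=[f+g:I\cap J\to A]$ and $[f][g]=[f\circ g:JI\to A]$. $A$ is contained in $Q_0$ via $a\mapsto[L_a:A\to A]$, $L_a(x)=ax$, and $Q_0$ is a left $H$-module algebra via $(h\cdot f)(x)=\sum h_1\cdot f(S(h_2)\cdot x)$. For a left $H$-module algebra $C$ let $Z(C)^H$ be the subalgebra of the central elements $z$ of $C$ with $h\cdot z=\varepsilon(h)z$ for all $h\in H$. Then $\widehat A$ is an $H$-module algebra (extending its $k$-module structure, with $h$ acting as $(1\otimes 1)\# h$) with unit $1_A$ and the product $(as)(bt)=(ab)(st)$ for $a,b\in A$, $s,t\in T$, and $f\mapsto f(1_A)$ is an isomorphism of $k$-algebras $T\to Z(\widehat A)^H$, by which we identify the two. Moreover: 1. The map $\psi: Z(\widehat A)^H\to Z(Q_0)^H$, $f\mapsto [f:I_f\to A]$ with $I_f=f^{-1}(A)\cap A$ $(f\in T)$, is an isomorphism of $k$-algebras. 2. $Z(Q_0)^H$ is a von Neumann regular, self-injective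 ring. 3. Every $\gamma\in\widehat A$ is of the form $\gamma=\sum_{j=1}^n a_jx_j$ with $a_j\in A$, $x_j\in Z(\widehat A)^H$, and there is an injective homomorphism of $k$-algebras $\overline\psi:\widehat A\to Q_0$ such that for each such expression $\overline\psi(\gamma)=[L_\gamma:I\to A]$, where $I=\bigcap_{j=1}^n I_{x_j}$ and $L_\gamma(y)=\gamma y$. 4. The image of $\overline\psi$, which is isomorphic to $\widehat A$, is the subalgebra of $Q_0$ generated by $A$ and $Z(Q_0)^H$. -/

import Mathlib

open scoped TensorProduct
open Coalgebra

universe u v w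

set_option linter.unusedSectionVars false

/-- `h ↦ h • m` as a `k`-linear map. -/
def orbitMap (k : Type*) {H M : Type*} [CommRing k] [Ring H] [Algebra k H] [AddCommGroup M]
    [Module k M] [Module H M] [IsScalarTower k H M] (m : M) : H →ₗ[k] M :=
  (LinearMap.toSpanSingleton H M m).restrictScalars k

/-- A (left) module algebra `A` over a Hopf algebra `H`: `A` is a `k`-algebra and a left
`H`-module with `h • 1 = ε(h) 1` and `h • (a b) = ∑ (h₁ • a) (h₂ • b)`. -/
class HModuleAlgebra (k H A : Type*) [CommRing k] [Ring H] [HopfAlgebra k H] [Ring A]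
    [Algebra k A] [Module H A] [IsScalarTower k H A] : Prop where
  smul_one : ∀ h : H, h • (1 : A) = algebraMap k A (counit h)
  smul_mul : ∀ (h : H) (a b : A), h • (a * b) =
    LinearMap.mul' k A (TensorProduct.map (orbitMap k a) (orbitMap k b) (comul (R := k) h))

/-- The smash product `A^e #_ν H` of the enveloping algebra `A^e = A ⊗ Aᵒᵖ` with `H`. Its underlying
`k`-module is `A^e ⊗ H`; its product, defined below, is
`((a ⊗ b) # h) ((a' ⊗ b') # g) = ∑ (a (h₁ • a') ⊗ (h₃ • b') b) # h₂ g`, i.e. the one determined by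
the twist `ν(h ⊗ (a ⊗ b)) = ∑ ((h₁ • a) ⊗ (h₃ • b)) ⊗ h₂`. -/
def SmashEnv (k : Type u) (H : Type v) (A : Type w) [CommRing k] [Ring H] [Algebra k H] [Ring A]
    [Algebra k A] : Type (max v w) :=
  (A ⊗[k] Aᵐᵒᵖ) ⊗[k] H

namespace SmashEnv

section Basic
variable (k : Type u) (H : Type v) (A : Type w) [CommRing k] [Ring H] [HopfAlgebra k H] [Ring A]
  [Algebra k A]

noncomputable instance : AddCommGroup (SmashEnv k H A) :=
  inferInstanceAs (AddCommGroup ((A ⊗[k] Aᵐᵒᵖ) ⊗[k] H))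

noncomputable instance : Module k (SmashEnv k H A) :=
  inferInstanceAs (Module k ((A ⊗[k] Aᵐᵒᵖ) ⊗[k] H))

variable [Module H A] [IsScalarTower k H A]

/-- The iterated comultiplication `h ↦ ∑ h₁ ⊗ (h₂ ⊗ h₃)`. -/
noncomputable def comul3 : H →ₐ[k] H ⊗[k] (H ⊗[k] H) :=
  (Algebra.TensorProduct.map (AlgHom.id k H) (Bialgebra.comulAlgHom k H)).comp
    (Bialgebra.comulAlgHom k H)

/-- `h₁ ⊗ (h₂ ⊗ h₃)` acts on `(A ⊗ Aᵒᵖ) ⊗ H` by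
`(a ⊗ b) ⊗ g ↦ ((h₁ • a) ⊗ (h₃ • b)) ⊗ h₂ g`. -/
noncomputable def act3 : H ⊗[k] (H ⊗[k] H) →ₐ[k] Module.End k ((A ⊗[k] Aᵐᵒᵖ) ⊗[k] H) :=
  (Module.endTensorEndAlgHom (R := k) (S := k) (A := k) (M := A ⊗[k] Aᵐᵒᵖ) (N := H)).comp <|
  (Algebra.TensorProduct.map
    ((Module.endTensorEndAlgHom (R := k) (S := k) (A := k) (M := A) (N := Aᵐᵒᵖ)).comp
      (Algebra.TensorProduct.map (Algebra.lsmul k k A) (Algebra.lsmul k k Aᵐᵒᵖ)))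
    (Algebra.lmul k H)).comp <|
  (Algebra.TensorProduct.assoc k k k H H H).symm.toAlgHom.comp
    (Algebra.TensorProduct.map (AlgHom.id k H) (Algebra.TensorProduct.comm k H H).toAlgHom)

theorem act3_tmul (p q r g : H) (a : A) (b : Aᵐᵒᵖ) :
    act3 k H A (p ⊗ₜ (q ⊗ₜ r)) ((a ⊗ₜ b) ⊗ₜ g) = ((p • a) ⊗ₜ (r • b)) ⊗ₜ (q * g) := by
  rfl

/-- Left multiplication by an element of `A ⊗ Aᵒᵖ` on `(A ⊗ Aᵒᵖ) ⊗ H`. -/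
noncomputable def leftEnv : A ⊗[k] Aᵐᵒᵖ →ₐ[k] Module.End k ((A ⊗[k] Aᵐᵒᵖ) ⊗[k] H) :=
  (Module.endTensorEndAlgHom (R := k) (S := k) (A := k) (M := A ⊗[k] Aᵐᵒᵖ) (N := H)).comp <|
    (Algebra.TensorProduct.includeLeft).comp (Algebra.lmul k _)

theorem leftEnv_tmul (x y : A ⊗[k] Aᵐᵒᵖ) (g : H) :
    leftEnv k H A x (y ⊗ₜ g) = (x * y) ⊗ₜ g := by
  rfl

/-- The product of the smash product: left multiplication by `x ⊗ h` is
`y ⊗ g ↦ x (∑ (h₁ ⊗ h₃) • y ⊗ h₂ g)` for `x, y ∈ A ⊗ Aᵒᵖ`. -/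
noncomputable def lmulSmash :
    (A ⊗[k] Aᵐᵒᵖ) ⊗[k] H →ₗ[k] Module.End k ((A ⊗[k] Aᵐᵒᵖ) ⊗[k] H) :=
  (LinearMap.mul' k _) ∘ₗ TensorProduct.map (leftEnv k H A).toLinearMap
    ((act3 k H A).comp (comul3 k H)).toLinearMap

theorem lmulSmash_tmul (x : A ⊗[k] Aᵐᵒᵖ) (h : H) :
    lmulSmash k H A (x ⊗ₜ h) = leftEnv k H A x * act3 k H A (comul3 k H h) := by
  simp [lmulSmash]

theorem coassoc5 : TensorProduct.assoc k H H (H ⊗[k] (H ⊗[k] H)) ∘ₗ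
      (TensorProduct.map comul (TensorProduct.map LinearMap.id comul)) ∘ₗ
      (TensorProduct.map LinearMap.id comul) ∘ₗ comul =
    TensorProduct.map LinearMap.id
      ((TensorProduct.map LinearMap.id (TensorProduct.assoc k H H H).toLinearMap) ∘ₗ
      (TensorProduct.assoc k H (H ⊗[k] H) H).toLinearMap ∘ₗ
      TensorProduct.map (TensorProduct.map LinearMap.id comul ∘ₗ comul) LinearMap.id) ∘ₗ
      (TensorProduct.map LinearMap.id comul) ∘ₗ (comul (R := k) (A := H)) := by
  open scoped RingTheory.LinearMap in simp only [coassoc_simps]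

/-- Auxiliary map on five tensor factors, used for the associativity of the smash product. -/
noncomputable def act5 (a a' : A) (b b' : Aᵐᵒᵖ) (g : H) :
    H ⊗[k] (H ⊗[k] (H ⊗[k] (H ⊗[k] H))) →ₗ[k] (A ⊗[k] Aᵐᵒᵖ) ⊗[k] H :=
  (TensorProduct.assoc k A Aᵐᵒᵖ H).symm.toLinearMap ∘ₗ
  (TensorProduct.map LinearMap.id (TensorProduct.comm k H Aᵐᵒᵖ).toLinearMap) ∘ₗ
  (TensorProduct.map (LinearMap.mul' k A) (TensorProduct.map LinearMap.id
    (LinearMap.mul' k Aᵐᵒᵖ ∘ₗ (TensorProduct.comm k Aᵐᵒᵖ Aᵐᵒᵖ).toLinearMap))) ∘ₗ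
  (TensorProduct.assoc k A A (H ⊗[k] (Aᵐᵒᵖ ⊗[k] Aᵐᵒᵖ))).symm.toLinearMap ∘ₗ
  TensorProduct.map (orbitMap k a) (TensorProduct.map (orbitMap k a')
    (TensorProduct.map (LinearMap.mulRight k g)
    (TensorProduct.map (orbitMap k b') (orbitMap k b))))

theorem act5_tmul (a a' : A) (b b' : Aᵐᵒᵖ) (g p q r s t : H) :
    act5 k H A a a' b b' g (p ⊗ₜ (q ⊗ₜ (r ⊗ₜ (s ⊗ₜ t)))) =
      (((p • a) * (q • a')) ⊗ₜ ((t • b) * (s • b'))) ⊗ₜ (r * g) := by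
  simp [act5, orbitMap]

theorem act3_left [HModuleAlgebra k H A] (a a' : A) (b b' : Aᵐᵒᵖ) (g : H)
    (X : H ⊗[k] (H ⊗[k] H)) :
    act3 k H A X (((a * a') ⊗ₜ (b * b')) ⊗ₜ g) =
      act5 k H A a a' b b' g ((TensorProduct.assoc k H H (H ⊗[k] (H ⊗[k] H)))
        (TensorProduct.map comul (TensorProduct.map LinearMap.id comul) X)) := by
  have hop : ∀ r : H, r • (b * b') = LinearMap.mul' k Aᵐᵒᵖ (TensorProduct.comm k Aᵐᵒᵖ Aᵐᵒᵖ
      (TensorProduct.map (orbitMap k b') (orbitMap k b) (comul (R := k) r))) := by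
    intro r
    apply MulOpposite.unop_injective
    rw [MulOpposite.unop_smul, MulOpposite.unop_mul, HModuleAlgebra.smul_mul (k := k)]
    induction (comul (R := k) r) using TensorProduct.induction_on with
    | zero => simp
    | tmul x y => simp [orbitMap]
    | add x y hx hy => simp [hx, hy]
  induction X using TensorProduct.induction_on with
  | zero => simp
  | add x y hx hy => simp [hx, hy]
  | tmul p X =>
    induction X using TensorProduct.induction_on with
    | zero => simp
    | add x y hx hy => simp [hx, hy, TensorProduct.tmul_add]
    | tmul q r =>
      rw [act3_tmul, hop, HModuleAlgebra.smul_mul (k := k)]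
      simp only [TensorProduct.map_tmul, LinearMap.id_coe, id_eq]
      induction (comul (R := k) p) using TensorProduct.induction_on with
      | zero => simp
      | add x y hx hy => simp [hx, hy, TensorProduct.add_tmul]
      | tmul x y =>
        induction (comul (R := k) r) using TensorProduct.induction_on with
        | zero => simp
        | add x y hx hy => simp only [hx, hy, TensorProduct.tmul_add, TensorProduct.add_tmul, map_add]
        | tmul z w => simp [act5_tmul, orbitMap]

theorem lmul_act3 (a a' : A) (b b' : Aᵐᵒᵖ) (g : H)
    (X : H ⊗[k] (H ⊗[k] H)) :
    lmulSmash k H A (act3 k H A X ((a ⊗ₜ b) ⊗ₜ 1)) ((a' ⊗ₜ b') ⊗ₜ g) =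
      act5 k H A a a' b b' g (TensorProduct.map LinearMap.id
      ((TensorProduct.map LinearMap.id (TensorProduct.assoc k H H H).toLinearMap) ∘ₗ
      (TensorProduct.assoc k H (H ⊗[k] H) H).toLinearMap ∘ₗ
      TensorProduct.map (TensorProduct.map LinearMap.id comul ∘ₗ comul) LinearMap.id) X) := by
  induction X using TensorProduct.induction_on with
  | zero => simp
  | add x y hx hy => simp only [hx, hy, map_add, LinearMap.add_apply]
  | tmul p X =>
    induction X using TensorProduct.induction_on with
    | zero => simp
    | add x y hx hy => simp only [hx, hy, TensorProduct.tmul_add, map_add, LinearMap.add_apply]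
    | tmul q r =>
      rw [act3_tmul, lmulSmash_tmul]
      simp only [mul_one, TensorProduct.map_tmul, LinearMap.id_coe, id_eq, LinearMap.comp_apply,
        Module.End.mul_apply]
      have : comul3 k H q = TensorProduct.map LinearMap.id comul (comul (R := k) q) := rfl
      rw [this]
      induction TensorProduct.map (LinearMap.id (R := k) (M := H)) (comul (R := k)) (comul (R := k) q) using TensorProduct.induction_on with
      | zero => simp
      | add x y hx hy => simp only [hx, hy, TensorProduct.add_tmul, TensorProduct.tmul_add, map_add, LinearMap.add_apply]
      | tmul s Y =>
        induction Y using TensorProduct.induction_on with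
        | zero => simp
        | add x y hx hy => simp only [hx, hy, TensorProduct.add_tmul, TensorProduct.tmul_add, map_add, LinearMap.add_apply]
        | tmul t u => simp [act3_tmul, leftEnv_tmul, act5_tmul]


variable {k H A}

theorem tripleInduction {P : H ⊗[k] (H ⊗[k] H) → Prop} (h0 : P 0)
    (ht : ∀ p q r, P (p ⊗ₜ (q ⊗ₜ r))) (ha : ∀ x y, P x → P y → P (x + y)) (x) : P x := by
  induction x using TensorProduct.induction_on with
  | zero => exact h0
  | add x y hx hy => exact ha x y hx hy
  | tmul p X =>
    induction X using TensorProduct.induction_on with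
    | zero => simpa using h0
    | add x y hx hy => rw [TensorProduct.tmul_add]; exact ha _ _ hx hy
    | tmul q r => exact ht p q r

theorem envInduction {P : (A ⊗[k] Aᵐᵒᵖ) ⊗[k] H → Prop} (h0 : P 0)
    (ht : ∀ a b h, P ((a ⊗ₜ b) ⊗ₜ h)) (ha : ∀ x y, P x → P y → P (x + y)) (x) : P x := by
  induction x using TensorProduct.induction_on with
  | zero => exact h0
  | add x y hx hy => exact ha x y hx hy
  | tmul X h =>
    induction X using TensorProduct.induction_on with
    | zero => simpa using h0
    | add x y hx hy => rw [TensorProduct.add_tmul]; exact ha _ _ hx hy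
    | tmul a b => exact ht a b h

theorem act_leftEnv [HModuleAlgebra k H A] (h : H) (a : A) (b : Aᵐᵒᵖ) :
    act3 k H A (comul3 k H h) * leftEnv k H A (a ⊗ₜ b) =
      lmulSmash k H A (act3 k H A (comul3 k H h) ((a ⊗ₜ b) ⊗ₜ 1)) := by
  refine LinearMap.ext fun x => ?_
  induction x using envInduction with
  | h0 => simp
  | ha x y hx hy => simp only [map_add, hx, hy]
  | ht a' b' g =>
    rw [lmul_act3, Module.End.mul_apply, leftEnv_tmul, Algebra.TensorProduct.tmul_mul_tmul,
      act3_left]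
    exact congrArg (act5 k H A a a' b b' g) (LinearMap.congr_fun (coassoc5 k H) h)

theorem lmul_act3_mul (X : H ⊗[k] (H ⊗[k] H)) (x : A ⊗[k] Aᵐᵒᵖ) (g : H) :
    lmulSmash k H A (act3 k H A X (x ⊗ₜ g)) =
      lmulSmash k H A (act3 k H A X (x ⊗ₜ 1)) * act3 k H A (comul3 k H g) := by
  induction X using tripleInduction with
  | h0 => simp
  | ha x y hx hy => simp only [map_add, LinearMap.add_apply, hx, hy, add_mul]
  | ht p q r =>
    induction x using TensorProduct.induction_on with
    | zero => simp
    | add x y hx hy => simp only [TensorProduct.add_tmul, map_add, hx, hy, add_mul]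
    | tmul a b =>
      simp only [act3_tmul, lmulSmash_tmul, map_mul, mul_one, mul_assoc]

theorem lmul_leftEnv (x : A ⊗[k] Aᵐᵒᵖ) (t : (A ⊗[k] Aᵐᵒᵖ) ⊗[k] H) :
    lmulSmash k H A (leftEnv k H A x t) = leftEnv k H A x * lmulSmash k H A t := by
  induction t using TensorProduct.induction_on with
  | zero => simp
  | add s t hs ht => simp only [map_add, hs, ht, mul_add]
  | tmul y g => simp only [leftEnv_tmul, lmulSmash_tmul, map_mul, mul_assoc]

theorem lmulSmash_mul [HModuleAlgebra k H A] (s t : (A ⊗[k] Aᵐᵒᵖ) ⊗[k] H) :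
    lmulSmash k H A (lmulSmash k H A s t) = lmulSmash k H A s * lmulSmash k H A t := by
  induction s using TensorProduct.induction_on with
  | zero => simp
  | add s s' hs hs' => simp only [map_add, LinearMap.add_apply, hs, hs', add_mul]
  | tmul x h =>
    induction t using envInduction with
    | h0 => simp
    | ha s t hs ht => simp only [map_add, hs, ht, mul_add]
    | ht a b g =>
      simp only [lmulSmash_tmul, Module.End.mul_apply, lmul_leftEnv]
      rw [lmul_act3_mul, ← act_leftEnv]
      simp only [mul_assoc]

theorem act_one [HModuleAlgebra k H A] (h g : H) :
    act3 k H A (comul3 k H h) ((1 ⊗ₜ 1) ⊗ₜ g) = (1 ⊗ₜ 1) ⊗ₜ (h * g) := by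
  have hop : ∀ r : H, r • (1 : Aᵐᵒᵖ) = counit (R := k) r • 1 := by
    intro r
    apply MulOpposite.unop_injective
    simp [HModuleAlgebra.smul_one (k := k), Algebra.algebraMap_eq_smul_one]
  have h1 : ∀ r : H, r • (1 : A) = counit (R := k) r • 1 := by
    intro r
    simp [HModuleAlgebra.smul_one (k := k), Algebra.algebraMap_eq_smul_one]
  have key : ∀ X : H ⊗[k] (H ⊗[k] H), act3 k H A X ((1 ⊗ₜ 1) ⊗ₜ g) = (1 ⊗ₜ 1) ⊗ₜ
      ((TensorProduct.lid k H (TensorProduct.map (counit (R := k)) ((TensorProduct.rid k H).toLinearMap ∘ₗ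
        TensorProduct.map LinearMap.id (counit (R := k))) X)) * g) := by
    intro X
    induction X using tripleInduction with
    | h0 => simp
    | ha x y hx hy => simp only [map_add, LinearMap.add_apply, hx, hy, add_mul, TensorProduct.tmul_add]
    | ht p q r =>
      rw [act3_tmul, hop, h1]
      simp [TensorProduct.smul_tmul', TensorProduct.tmul_smul, smul_smul, mul_comm]
  rw [key]
  congr 2
  have e1 : comul3 k H h = TensorProduct.map LinearMap.id comul (comul (R := k) h) := rfl
  rw [e1, ← LinearMap.comp_apply (TensorProduct.map _ _), ← TensorProduct.map_comp]
  have e2 : ((TensorProduct.rid k H).toLinearMap ∘ₗ TensorProduct.map LinearMap.id (counit (R := k)))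
      ∘ₗ comul = (LinearMap.id (R := k) (M := H)) := by
    ext x
    have := lTensor_counit_comul (R := k) x
    rw [LinearMap.lTensor] at this
    simp [this]
  rw [e2]
  have := rTensor_counit_comul (R := k) h
  rw [LinearMap.rTensor] at this
  simp [this]

variable [HModuleAlgebra k H A]

noncomputable instance : Mul (SmashEnv k H A) := ⟨fun s t => lmulSmash k H A s t⟩
noncomputable instance : One (SmashEnv k H A) :=
  ⟨((1 ⊗ₜ[k] 1) ⊗ₜ[k] 1 : (A ⊗[k] Aᵐᵒᵖ) ⊗[k] H)⟩

theorem mul_def (s t : SmashEnv k H A) : s * t = lmulSmash k H A s t := rfl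

theorem lmulSmash_one : lmulSmash k H A ((1 ⊗ₜ 1) ⊗ₜ 1) = 1 := by
  rw [lmulSmash_tmul, map_one, map_one, mul_one, ← Algebra.TensorProduct.one_def, map_one]

noncomputable instance : Ring (SmashEnv k H A) :=
  { (inferInstance : AddCommGroup (SmashEnv k H A)),
    (inferInstance : Mul (SmashEnv k H A)), (inferInstance : One (SmashEnv k H A)) with
    left_distrib := fun a b c => (lmulSmash k H A a).map_add b c
    right_distrib := fun a b c => LinearMap.congr_fun ((lmulSmash k H A).map_add a b) c
    zero_mul := fun a => LinearMap.congr_fun ((lmulSmash k H A).map_zero) a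
    mul_zero := fun a => (lmulSmash k H A a).map_zero
    mul_assoc := fun a b c => LinearMap.congr_fun (lmulSmash_mul (k := k) (H := H) (A := A) a b) c
    one_mul := fun a => LinearMap.congr_fun (lmulSmash_one (k := k) (H := H) (A := A)) a
    mul_one := fun a => by
      change lmulSmash k H A a ((1 ⊗ₜ 1) ⊗ₜ 1) = a
      induction a using TensorProduct.induction_on with
      | zero => simp
      | add s t hs ht => simp only [map_add, LinearMap.add_apply, hs, ht]
      | tmul x h =>
        rw [lmulSmash_tmul, Module.End.mul_apply, act_one, leftEnv_tmul,
          ← Algebra.TensorProduct.one_def, mul_one, mul_one] }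

noncomputable instance : Algebra k (SmashEnv k H A) :=
  Algebra.ofModule (fun r x y => LinearMap.congr_fun ((lmulSmash k H A).map_smul r x) y)
    (fun r x y => (lmulSmash k H A x).map_smul r y)

/-- The generator `(a ⊗ b) # h` -/
noncomputable def mk (a b : A) (h : H) : SmashEnv k H A :=
  ((a ⊗ₜ[k] MulOpposite.op b) ⊗ₜ[k] h : (A ⊗[k] Aᵐᵒᵖ) ⊗[k] H)

/-- The `k`-linear map `(a ⊗ b) # h ↦ L_a ∘ R_b ∘ λ_h`. -/
noncomputable def toEndLin : (A ⊗[k] Aᵐᵒᵖ) ⊗[k] H →ₗ[k] Module.End k A :=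
  LinearMap.mul' k _ ∘ₗ TensorProduct.map
    (LinearMap.mul' k _ ∘ₗ TensorProduct.map (Algebra.lsmul k k A).toLinearMap
      (Algebra.lsmul k k A : Aᵐᵒᵖ →ₐ[k] Module.End k A).toLinearMap)
    (Algebra.lsmul k k A : H →ₐ[k] Module.End k A).toLinearMap

theorem toEndLin_tmul (a x : A) (b : Aᵐᵒᵖ) (h : H) :
    toEndLin (k := k) ((a ⊗ₜ b) ⊗ₜ h) x = a * ((h • x) * b.unop) := by
  simp [toEndLin]

theorem smul_triple (h : H) (a b x : A) : h • (a * (x * b)) =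
    toEndLin (k := k) (act3 k H A (comul3 k H h) ((a ⊗ₜ MulOpposite.op b) ⊗ₜ 1)) x := by
  have e1 : comul3 k H h = TensorProduct.map LinearMap.id comul (comul (R := k) h) := rfl
  rw [e1, HModuleAlgebra.smul_mul (k := k)]
  induction (comul (R := k) h) using TensorProduct.induction_on with
  | zero => simp
  | add s t hs ht => simp only [map_add, LinearMap.add_apply, hs, ht]
  | tmul p q =>
    have : orbitMap k (x * b) q = q • (x * b) := rfl
    rw [TensorProduct.map_tmul, TensorProduct.map_tmul, this, HModuleAlgebra.smul_mul (k := k)]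
    induction (comul (R := k) q) using TensorProduct.induction_on with
    | zero => simp
    | add s t hs ht =>
      simp only [map_add, LinearMap.add_apply, hs, ht, TensorProduct.tmul_add]
    | tmul q r => simp [act3_tmul, toEndLin_tmul, orbitMap]

theorem toEndLin_mul (s t : (A ⊗[k] Aᵐᵒᵖ) ⊗[k] H) :
    toEndLin (k := k) (lmulSmash k H A s t) = toEndLin s * toEndLin t := by
  refine LinearMap.ext fun x => ?_
  induction s using envInduction with
  | h0 => simp
  | ha s s' hs hs' => simp only [map_add, LinearMap.add_apply, hs, hs', add_mul]
  | ht a b h =>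
    induction t using envInduction with
    | h0 => simp
    | ha s t hs ht => simp only [map_add, hs, ht, mul_add, LinearMap.add_apply]
    | ht a' b' g =>
      rw [lmulSmash_tmul, Module.End.mul_apply, Module.End.mul_apply, toEndLin_tmul, toEndLin_tmul]
      have := smul_triple (k := k) h a' b'.unop (g • x)
      rw [this, MulOpposite.op_unop]
      generalize comul3 k H h = X
      induction X using tripleInduction with
      | h0 => simp
      | ha s t hs ht => simp only [map_add, LinearMap.add_apply, hs, ht, mul_add, add_mul]
      | ht p q r =>
        simp [act3_tmul, toEndLin_tmul, leftEnv_tmul, mul_smul, mul_assoc]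

/-- The action of the smash product on `A`: `(a ⊗ b) # h` acts as `L_a ∘ R_b ∘ λ_h`. -/
noncomputable def toEnd : SmashEnv k H A →ₐ[k] Module.End k A :=
  AlgHom.ofLinearMap (R := k) (A := SmashEnv k H A) (B := Module.End k A) (toEndLin (k := k))
    (by
      refine LinearMap.ext fun x => ?_
      refine (toEndLin_tmul (k := k) (H := H) 1 x 1 1).trans ?_
      simp)
    (fun s t => toEndLin_mul s t)

noncomputable instance : Module (SmashEnv k H A) A :=
  Module.compHom A (toEnd (k := k) (H := H) (A := A)).toRingHom

theorem smul_def (s : SmashEnv k H A) (x : A) : s • x = toEnd s x := rfl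

theorem mk_smul (a b : A) (h : H) (x : A) : mk (k := k) a b h • x = a * (h • x) * b := by
  rw [smul_def, mul_assoc]
  exact toEndLin_tmul (k := k) a x (MulOpposite.op b) h

instance : IsScalarTower k (SmashEnv k H A) A :=
  ⟨fun r s x => by simp [smul_def]⟩

end Basic
end SmashEnv

section Adjoint

variable {k H V W U : Type*} [CommRing k] [Ring H] [HopfAlgebra k H] [AddCommGroup V] [Module k V]
  [AddCommGroup W] [Module k W] [AddCommGroup U] [Module k U]
  (σ : H →ₐ[k] Module.End k V) (τ : H →ₐ[k] Module.End k W)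

/-- For `H`-modules `V`, `W` (given by `σ`, `τ`) and `f : V → W`, the bilinear map
`p ⊗ q ↦ (v ↦ p • f (S(q) • v))`. -/
noncomputable def adjPair (f : V →ₗ[k] W) : H ⊗[k] H →ₗ[k] (V →ₗ[k] W) :=
  TensorProduct.lift <| LinearMap.mk₂ k
    (fun p q => τ p ∘ₗ f ∘ₗ σ (HopfAlgebra.antipode k q))
    (fun p p' q => by ext; simp) (fun c p q => by ext; simp)
    (fun p q q' => by ext; simp) (fun c p q => by ext; simp)

theorem adjPair_tmul (f : V →ₗ[k] W) (p q : H) (v : V) :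
    adjPair σ τ f (p ⊗ₜ q) v = τ p (f (σ (HopfAlgebra.antipode k q) v)) := by
  simp [adjPair]

/-- The adjoint action `(h • f)(v) = ∑ h₁ • f (S(h₂) • v)` on `k`-linear maps. -/
noncomputable def adjAct (f : V →ₗ[k] W) : H →ₗ[k] (V →ₗ[k] W) := adjPair σ τ f ∘ₗ comul

/-- `p ⊗ q ↦ F(p) ∘ σ(q)` -/
noncomputable def pairRight (F : H →ₗ[k] (V →ₗ[k] W)) : H ⊗[k] H →ₗ[k] (V →ₗ[k] W) :=
  TensorProduct.lift <| LinearMap.mk₂ k (fun p q => F p ∘ₗ σ q)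
    (fun p p' q => by ext; simp) (fun c p q => by ext; simp)
    (fun p q q' => by ext; simp) (fun c p q => by ext; simp)

theorem pairRight_tmul (F : H →ₗ[k] (V →ₗ[k] W)) (p q : H) :
    pairRight σ F (p ⊗ₜ q) = F p ∘ₗ σ q := by
  simp [pairRight]

theorem pairRight_adjAct (f : V →ₗ[k] W) (h : H) :
    pairRight σ (adjAct σ τ f) (comul h) = τ h ∘ₗ f := by
  have key : ∀ X : H ⊗[k] H, pairRight σ (adjAct σ τ f) X =
      TensorProduct.lift (LinearMap.mk₂ k (fun p q => τ p ∘ₗ f ∘ₗ σ q)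
        (fun p p' q => by ext; simp) (fun c p q => by ext; simp)
        (fun p q q' => by ext; simp) (fun c p q => by ext; simp))
      (TensorProduct.map LinearMap.id (LinearMap.mul' k H ∘ₗ
        TensorProduct.map (HopfAlgebra.antipode k) LinearMap.id)
        (TensorProduct.assoc k H H H (TensorProduct.map comul LinearMap.id X))) := by
    intro X
    induction X using TensorProduct.induction_on with
    | zero => simp
    | add x y hx hy => simp only [map_add, hx, hy]
    | tmul p q =>
      rw [pairRight_tmul, adjAct, LinearMap.comp_apply, TensorProduct.map_tmul]
      induction (comul (R := k) p) using TensorProduct.induction_on with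
      | zero => simp
      | add x y hx hy => simp only [map_add, TensorProduct.add_tmul, LinearMap.add_comp, hx, hy]
      | tmul p r => ext v; simp [adjPair_tmul]
  rw [key]
  have e1 := coassoc_apply (R := k) h
  rw [LinearMap.rTensor, LinearMap.lTensor] at e1
  rw [e1, ← LinearMap.comp_apply (TensorProduct.map _ _), ← TensorProduct.map_comp,
    LinearMap.comp_assoc]
  have e2 := HopfAlgebra.mul_antipode_rTensor_comul (R := k) (A := H)
  rw [LinearMap.rTensor] at e2
  rw [e2, TensorProduct.map_comp, LinearMap.comp_apply]
  have e3 := lTensor_counit_comul (R := k) h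
  rw [LinearMap.lTensor] at e3
  rw [e3]
  ext v
  simp

theorem adjAct_unique (f : V →ₗ[k] W) (F : H →ₗ[k] (V →ₗ[k] W))
    (hF : ∀ h, pairRight σ F (comul h) = τ h ∘ₗ f) : F = adjAct σ τ f := by
  ext h : 1
  have key : ∀ X : H ⊗[k] H, adjPair σ τ f X =
      pairRight σ F
      (TensorProduct.map LinearMap.id (LinearMap.mul' k H ∘ₗ
        TensorProduct.map LinearMap.id (HopfAlgebra.antipode k))
        (TensorProduct.assoc k H H H (TensorProduct.map comul LinearMap.id X))) := by
    intro X
    induction X using TensorProduct.induction_on with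
    | zero => simp
    | add x y hx hy => simp only [map_add, hx, hy]
    | tmul p q =>
      have e : adjPair σ τ f (p ⊗ₜ q) = pairRight σ F (comul p) ∘ₗ σ (HopfAlgebra.antipode k q) := by
        rw [hF]; ext v; simp [adjPair_tmul]
      rw [e, TensorProduct.map_tmul]
      induction (comul (R := k) p) using TensorProduct.induction_on with
      | zero => simp
      | add x y hx hy => simp only [map_add, TensorProduct.add_tmul, LinearMap.add_comp, hx, hy]
      | tmul p r => ext v; simp [pairRight_tmul]
  rw [adjAct, LinearMap.comp_apply, key]
  have e1 := coassoc_apply (R := k) h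
  rw [LinearMap.rTensor, LinearMap.lTensor] at e1
  rw [e1, ← LinearMap.comp_apply (TensorProduct.map _ _), ← TensorProduct.map_comp,
    LinearMap.comp_assoc]
  have e2 := HopfAlgebra.mul_antipode_lTensor_comul (R := k) (A := H)
  rw [LinearMap.lTensor] at e2
  rw [e2, TensorProduct.map_comp, LinearMap.comp_apply]
  have e3 := lTensor_counit_comul (R := k) h
  rw [LinearMap.lTensor] at e3
  rw [e3]
  ext v
  simp [pairRight_tmul]

theorem adjAct_one (f : V →ₗ[k] W) : adjAct σ τ f 1 = f := by
  ext v
  simp [adjAct, Algebra.TensorProduct.one_def, adjPair_tmul]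

theorem adjAct_mul (f : V →ₗ[k] W) (h g : H) :
    adjAct σ τ f (h * g) = adjAct σ τ (adjAct σ τ f g) h := by
  simp only [adjAct, LinearMap.comp_apply, Bialgebra.comul_mul]
  generalize comul (R := k) h = X
  generalize comul (R := k) g = Y
  ext v
  induction X using TensorProduct.induction_on with
  | zero => simp
  | add x y hx hy => simp only [add_mul, map_add, LinearMap.add_apply, hx, hy]
  | tmul p q =>
    rw [adjPair_tmul]
    induction Y using TensorProduct.induction_on with
    | zero => simp
    | add x y hx hy => simp only [mul_add, map_add, LinearMap.add_apply, hx, hy]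
    | tmul r s =>
      simp [adjPair_tmul, HopfAlgebra.antipode_mul_antidistrib]

theorem adjAct_add (f g : V →ₗ[k] W) : adjAct σ τ (f + g) = adjAct σ τ f + adjAct σ τ g := by
  ext h v
  simp only [adjAct, LinearMap.comp_apply, LinearMap.add_apply]
  induction (comul (R := k) h) using TensorProduct.induction_on with
  | zero => simp
  | add x y hx hy => simp only [map_add, LinearMap.add_apply, hx, hy]; abel
  | tmul p q => simp [adjPair_tmul]

theorem adjAct_zero : adjAct σ τ (0 : V →ₗ[k] W) = 0 := by
  have := adjAct_add σ τ (0 : V →ₗ[k] W) 0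
  rw [add_zero] at this
  exact left_eq_add.mp this

/-- The adjoint action is compatible with intertwiners in both arguments. -/
theorem adjAct_comp {V' : Type*} [AddCommGroup V'] [Module k V'] (σ' : H →ₐ[k] Module.End k V')
    (f : V →ₗ[k] W) (j : V' →ₗ[k] V) (hj : ∀ h, j ∘ₗ σ' h = σ h ∘ₗ j) (h : H) (v : V') :
    adjAct σ' τ (f ∘ₗ j) h v = adjAct σ τ f h (j v) := by
  simp only [adjAct, LinearMap.comp_apply]
  induction (comul (R := k) h) using TensorProduct.induction_on with
  | zero => simp
  | add x y hx hy => simp only [map_add, LinearMap.add_apply, hx, hy]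
  | tmul p q =>
    have := LinearMap.congr_fun (hj (HopfAlgebra.antipode k q)) v
    simp only [LinearMap.comp_apply] at this
    simp [adjPair_tmul, this]

end Adjoint

/-- An `H`-stable two-sided ideal of `A`. -/
structure HIdeal (H A : Type*) [Ring H] [Ring A] [Module H A] extends Submodule Aᵐᵒᵖ A where
  mul_mem_left' : ∀ (a : A) {x : A}, x ∈ carrier → a * x ∈ carrier
  hsmul_mem' : ∀ (h : H) {x : A}, x ∈ carrier → h • x ∈ carrier

namespace HIdeal

section Basic
variable {H A : Type*} [Ring H] [Ring A] [Module H A]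

theorem mul_left (I : HIdeal H A) (a : A) {x : A} (hx : x ∈ I.toSubmodule) :
    a * x ∈ I.toSubmodule := I.mul_mem_left' a hx

theorem mul_right (I : HIdeal H A) (a : A) {x : A} (hx : x ∈ I.toSubmodule) :
    x * a ∈ I.toSubmodule := I.toSubmodule.smul_mem (MulOpposite.op a) hx

theorem hsmul (I : HIdeal H A) (h : H) {x : A} (hx : x ∈ I.toSubmodule) :
    h • x ∈ I.toSubmodule := I.hsmul_mem' h hx

/-- `I` has zero left annihilator and zero right annihilator in `A`. -/
def Faithful (I : HIdeal H A) : Prop :=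
  (∀ a : A, (∀ x ∈ I.toSubmodule, a * x = 0) → a = 0) ∧
    (∀ a : A, (∀ x ∈ I.toSubmodule, x * a = 0) → a = 0)

/-- The whole algebra. -/
def top : HIdeal H A where
  toSubmodule := ⊤
  mul_mem_left' _ _ _ := trivial
  hsmul_mem' _ _ _ := trivial

/-- The intersection of two `H`-stable ideals. -/
def inf (I J : HIdeal H A) : HIdeal H A where
  toSubmodule := I.toSubmodule ⊓ J.toSubmodule
  mul_mem_left' a _ hx := ⟨I.mul_mem_left' a hx.1, J.mul_mem_left' a hx.2⟩
  hsmul_mem' h _ hx := ⟨I.hsmul_mem' h hx.1, J.hsmul_mem' h hx.2⟩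

theorem top_faithful : (top : HIdeal H A).Faithful :=
  ⟨fun a h => by simpa using h 1 trivial, fun a h => by simpa using h 1 trivial⟩

/-- The action of `H` on an `H`-stable ideal. -/
def act (k : Type*) [CommRing k] [Algebra k H] [Algebra k A] [IsScalarTower k H A]
    (I : HIdeal H A) : H →ₐ[k] Module.End k I.toSubmodule where
  toFun h :=
    { toFun := fun x => ⟨h • x.1, I.hsmul h x.2⟩
      map_add' := fun x y => Subtype.ext (smul_add h x.1 y.1)
      map_smul' := fun c x => Subtype.ext (smul_comm h c x.1) }
  map_one' := by ext x; exact one_smul H x.1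
  map_mul' h g := by ext x; exact mul_smul h g x.1
  map_zero' := by ext x; exact zero_smul H x.1
  map_add' h g := by ext x; exact add_smul h g x.1
  commutes' c := by ext x; exact algebraMap_smul H c x.1

end Basic

section Mul
variable (k : Type*) {H A : Type*} [CommRing k] [Ring H] [HopfAlgebra k H] [Ring A]
  [Algebra k A] [Module H A] [IsScalarTower k H A] [HModuleAlgebra k H A]

theorem hsmul_mul_mem (k : Type*) {H A : Type*} [CommRing k] [Ring H] [HopfAlgebra k H]
    [Ring A] [Algebra k A] [Module H A] [IsScalarTower k H A] [HModuleAlgebra k H A]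
    (S : Submodule Aᵐᵒᵖ A) (I J : HIdeal H A)
    (hS : ∀ x ∈ I.toSubmodule, ∀ y ∈ J.toSubmodule, x * y ∈ S) (h : H) {x y : A}
    (hx : x ∈ I.toSubmodule) (hy : y ∈ J.toSubmodule) : h • (x * y) ∈ S := by
  rw [HModuleAlgebra.smul_mul (k := k)]
  induction (comul (R := k) h) using TensorProduct.induction_on with
  | zero => simp
  | add s t hs ht => simpa only [map_add] using S.add_mem hs ht
  | tmul p q => exact hS _ (I.hsmul p hx) _ (J.hsmul q hy)

/-- The product `I J` of two `H`-stable ideals. -/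
def mul (I J : HIdeal H A) : HIdeal H A where
  toSubmodule := Submodule.span Aᵐᵒᵖ {z | ∃ x ∈ I.toSubmodule, ∃ y ∈ J.toSubmodule, x * y = z}
  mul_mem_left' a z hz := by
    refine Submodule.span_induction (p := fun z _ => a * z ∈ Submodule.span Aᵐᵒᵖ _)
      ?_ ?_ ?_ ?_ hz
    · rintro _ ⟨x, hx, y, hy, rfl⟩
      exact Submodule.subset_span ⟨a * x, I.mul_left a hx, y, hy, mul_assoc a x y⟩
    · simp
    · intro x y _ _ hx hy
      rw [mul_add]
      exact Submodule.add_mem _ hx hy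
    · intro b x _ hx
      rw [mul_smul_comm]
      exact Submodule.smul_mem _ b hx
  hsmul_mem' h z hz := by
    let S : Set A := {z | ∃ x ∈ I.toSubmodule, ∃ y ∈ J.toSubmodule, x * y = z}
    have mem_gen : ∀ {x y : A}, x ∈ I.toSubmodule → y ∈ J.toSubmodule →
        x * y ∈ Submodule.span Aᵐᵒᵖ S :=
      fun {x y} hx hy => Submodule.subset_span ⟨x, hx, y, hy, rfl⟩
    change h • z ∈ Submodule.span Aᵐᵒᵖ S
    change z ∈ Submodule.span Aᵐᵒᵖ S at hz
    induction hz using Submodule.span_induction generalizing h with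
    | mem z hz =>
      obtain ⟨x, hx, y, hy, rfl⟩ := hz
      exact hsmul_mul_mem k _ I J
        (fun x' hx' y' hy' => mem_gen hx' hy') h hx hy
    | zero => simp
    | add x y _ _ hx hy => rw [smul_add]; exact Submodule.add_mem _ (hx h) (hy h)
    | smul b x _ hx =>
      change h • (x * b.unop) ∈ _
      rw [HModuleAlgebra.smul_mul (k := k)]
      induction (comul (R := k) h) using TensorProduct.induction_on with
      | zero => simp
      | add s t hs ht => simpa only [map_add] using Submodule.add_mem _ hs ht
      | tmul p q => exact Submodule.smul_mem _ (MulOpposite.op (q • b.unop)) (hx p)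

theorem mul_mem_mul (I J : HIdeal H A) {x y : A} (hx : x ∈ I.toSubmodule)
    (hy : y ∈ J.toSubmodule) : x * y ∈ (mul k I J).toSubmodule :=
  Submodule.subset_span ⟨x, hx, y, hy, rfl⟩

theorem mul_le (I J : HIdeal H A) (S : Submodule Aᵐᵒᵖ A)
    (h : ∀ x ∈ I.toSubmodule, ∀ y ∈ J.toSubmodule, x * y ∈ S) : (mul k I J).toSubmodule ≤ S := by
  refine Submodule.span_le.2 ?_
  rintro _ ⟨x, hx, y, hy, rfl⟩
  exact h x hx y hy

theorem mul_le_left (I J : HIdeal H A) : (mul k I J).toSubmodule ≤ I.toSubmodule :=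
  mul_le k I J _ fun _ hx y _ => I.mul_right y hx

theorem mul_le_right (I J : HIdeal H A) : (mul k I J).toSubmodule ≤ J.toSubmodule :=
  mul_le k I J _ fun x _ _ hy => J.mul_left x hy

theorem mul_faithful {I J : HIdeal H A} (hI : I.Faithful) (hJ : J.Faithful) :
    (mul k I J).Faithful := by
  constructor
  · intro a ha
    refine hI.1 a fun x hx => hJ.1 _ fun y hy => ?_
    rw [mul_assoc]
    exact ha _ (mul_mem_mul k I J hx hy)
  · intro a ha
    refine hJ.2 a fun y hy => hI.2 _ fun x hx => ?_
    rw [← mul_assoc]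
    exact ha _ (mul_mem_mul k I J hx hy)

theorem inf_faithful (k : Type*) {H A : Type*} [CommRing k] [Ring H] [HopfAlgebra k H]
    [Ring A] [Algebra k A] [Module H A] [IsScalarTower k H A] [HModuleAlgebra k H A]
    {I J : HIdeal H A} (hI : I.Faithful) (hJ : J.Faithful) :
    (inf I J).Faithful := by
  have hm := mul_faithful k hI hJ
  have hle : ∀ x ∈ (mul k I J).toSubmodule, x ∈ (inf I J).toSubmodule :=
    fun x hx => ⟨mul_le_left k I J hx, mul_le_right k I J hx⟩
  exact ⟨fun a h => hm.1 a fun x hx => h x (hle x hx),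
    fun a h => hm.2 a fun x hx => h x (hle x hx)⟩

end Mul
end HIdeal

/-- A right `A`-linear map `f : I → A` defined on an `H`-stable ideal `I` of `A` with zero left
and right annihilator. -/
structure PartialHom (H A : Type*) [Ring H] [Ring A] [Module H A] where
  dom : HIdeal H A
  faithful : dom.Faithful
  map : dom.toSubmodule →ₗ[Aᵐᵒᵖ] A

namespace PartialHom

variable (k : Type u) {H : Type v} {A : Type w} [CommRing k] [Ring H] [HopfAlgebra k H] [Ring A]
  [Algebra k A] [Module H A] [IsScalarTower k H A] [HModuleAlgebra k H A]

/-- Two partial maps are equivalent if they agree on some `H`-stable ideal with zero left and right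
annihilator. -/
def Rel (f g : PartialHom H A) : Prop :=
  ∃ K : HIdeal H A, K.Faithful ∧ ∃ (hf : K.toSubmodule ≤ f.dom.toSubmodule)
    (hg : K.toSubmodule ≤ g.dom.toSubmodule),
    ∀ x (hx : x ∈ K.toSubmodule), f.map ⟨x, hf hx⟩ = g.map ⟨x, hg hx⟩

theorem rel_trans (k : Type*) {H A : Type*} [CommRing k] [Ring H] [HopfAlgebra k H]
    [Ring A] [Algebra k A] [Module H A] [IsScalarTower k H A] [HModuleAlgebra k H A]
    {f g l : PartialHom H A} (h₁ : Rel f g) (h₂ : Rel g l) : Rel f l := by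
  obtain ⟨K, hK, hf, hg, h⟩ := h₁
  obtain ⟨L, hL, hg', hl, h'⟩ := h₂
  exact ⟨K.inf L, HIdeal.inf_faithful k hK hL, fun x hx => hf hx.1, fun x hx => hl hx.2,
    fun x hx => (h x hx.1).trans (h' x hx.2)⟩

variable (H A) in
/-- The equivalence relation defining the Martindale quotient ring. -/
def setoid : Setoid (PartialHom H A) where
  r := Rel
  iseqv :=
    { refl := fun f => ⟨f.dom, f.faithful, le_rfl, le_rfl, fun _ _ => rfl⟩
      symm := fun ⟨K, hK, hf, hg, h⟩ => ⟨K, hK, hg, hf, fun x hx => (h x hx).symm⟩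
      trans := rel_trans k }

theorem map_mul_right (f : PartialHom H A) (x : f.dom.toSubmodule) (a : A) :
    f.map ⟨x.1 * a, f.dom.mul_right a x.2⟩ = f.map x * a :=
  f.map.map_smul (MulOpposite.op a) x

theorem map_mem (f : PartialHom H A) (J : HIdeal H A) {x : A}
    (hx : x ∈ (HIdeal.mul k f.dom J).toSubmodule) :
    f.map ⟨x, HIdeal.mul_le_left k _ _ hx⟩ ∈ J.toSubmodule := by
  have : (HIdeal.mul k f.dom J).toSubmodule ≤
      (J.toSubmodule.comap f.map).map f.dom.toSubmodule.subtype := by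
    refine HIdeal.mul_le k _ _ _ fun x hx y hy => ?_
    refine ⟨⟨x * y, f.dom.mul_right y hx⟩, ?_, rfl⟩
    change f.map _ ∈ J.toSubmodule
    rw [map_mul_right f ⟨x, hx⟩ y]
    exact J.mul_left _ hy
  obtain ⟨y, hy, rfl⟩ := this hx
  exact hy

/-- `f + g : I ∩ J → A`. -/
def add (f g : PartialHom H A) : PartialHom H A where
  dom := f.dom.inf g.dom
  faithful := HIdeal.inf_faithful k f.faithful g.faithful
  map := f.map ∘ₗ Submodule.inclusion inf_le_left + g.map ∘ₗ Submodule.inclusion inf_le_right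

/-- `f g : J I → A`, `x ↦ f (g x)`, for `f : I → A` and `g : J → A`. -/
def mul (f g : PartialHom H A) : PartialHom H A where
  dom := HIdeal.mul k g.dom f.dom
  faithful := HIdeal.mul_faithful k g.faithful f.faithful
  map := f.map ∘ₗ LinearMap.codRestrict f.dom.toSubmodule
    (g.map ∘ₗ Submodule.inclusion (HIdeal.mul_le_left k g.dom f.dom))
    (fun x => map_mem k g f.dom x.2)

/-- `-f`. -/
def neg (f : PartialHom H A) : PartialHom H A := ⟨f.dom, f.faithful, -f.map⟩

variable (H) in
/-- Left multiplication by `a`, defined on all of `A`. -/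
def left (a : A) : PartialHom H A where
  dom := HIdeal.top
  faithful := HIdeal.top_faithful
  map :=
    { toFun := fun x => a * x.1
      map_add' := fun x y => mul_add a x.1 y.1
      map_smul' := fun b x => (mul_assoc a x.1 b.unop).symm }

/-- The underlying `k`-linear map. -/
def lin (f : PartialHom H A) : f.dom.toSubmodule →ₗ[k] A := f.map.restrictScalars k

/-- The values of `h • f`: `x ↦ ∑ h₁ • f (S(h₂) • x)`. -/
noncomputable def actLin (f : PartialHom H A) : H →ₗ[k] (f.dom.toSubmodule →ₗ[k] A) :=
  adjAct (f.dom.act k) (Algebra.lsmul k k A) (f.lin k)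

theorem sum_actLin (f : PartialHom H A) (h : H) :
    pairRight (f.dom.act k) (actLin k f) (comul h) = Algebra.lsmul k k A h ∘ₗ f.lin k :=
  pairRight_adjAct _ _ _ _

/-- The diagonal action of `H` on `I ⊗ A`. -/
noncomputable def diagAct (I : HIdeal H A) : H →ₐ[k] Module.End k (I.toSubmodule ⊗[k] A) :=
  (Module.endTensorEndAlgHom (R := k) (S := k) (A := k) (M := I.toSubmodule) (N := A)).comp <|
    (Algebra.TensorProduct.map (I.act k) (Algebra.lsmul k k A)).comp (Bialgebra.comulAlgHom k H)

/-- `x ⊗ a ↦ x a`. -/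
noncomputable def mulMap (I : HIdeal H A) : I.toSubmodule ⊗[k] A →ₗ[k] I.toSubmodule :=
  TensorProduct.lift <| LinearMap.mk₂ k (fun x a => ⟨x.1 * a, I.mul_right a x.2⟩)
    (fun x y a => Subtype.ext (add_mul x.1 y.1 a))
    (fun c x a => Subtype.ext (smul_mul_assoc c x.1 a))
    (fun x a b => Subtype.ext (mul_add x.1 a b))
    (fun c x a => Subtype.ext (mul_smul_comm c x.1 a))

theorem mulMap_tmul (I : HIdeal H A) (x : I.toSubmodule) (a : A) :
    mulMap k I (x ⊗ₜ a) = ⟨x.1 * a, I.mul_right a x.2⟩ := rfl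

theorem mulMap_diagAct (I : HIdeal H A) (h : H) :
    mulMap k I ∘ₗ diagAct k I h = I.act k h ∘ₗ mulMap k I := by
  ext x a
  change _ = h • (x.1 * a)
  rw [HModuleAlgebra.smul_mul (k := k)]
  change (mulMap k I (Module.endTensorEndAlgHom (Algebra.TensorProduct.map (I.act k)
    (Algebra.lsmul k k A) (comul h)) (x ⊗ₜ a))).1 = _
  induction (comul (R := k) h) using TensorProduct.induction_on with
  | zero => simp
  | add s t hs ht => simp only [map_add, LinearMap.add_apply, Submodule.coe_add, hs, ht]
  | tmul p q => rfl

/-- `x ⊗ a ↦ F(h)(x) a`. -/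
noncomputable def tailMul {V : Type*} [AddCommGroup V] [Module k V] (F : H →ₗ[k] (V →ₗ[k] A)) :
    H →ₗ[k] (V ⊗[k] A →ₗ[k] A) where
  toFun h := LinearMap.mul' k A ∘ₗ TensorProduct.map (F h) LinearMap.id
  map_add' h g := by ext; simp [add_mul]
  map_smul' c h := by ext; simp

theorem actLin_mul_right (f : PartialHom H A) (h : H) (x : f.dom.toSubmodule) (a : A) :
    actLin k f h ⟨x.1 * a, f.dom.mul_right a x.2⟩ = actLin k f h x * a := by
  have e := adjAct_unique (diagAct k f.dom) (Algebra.lsmul k k A) (f.lin k ∘ₗ mulMap k f.dom)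
    (tailMul k (actLin k f)) ?_
  · have e1 := adjAct_comp (f.dom.act k) (Algebra.lsmul k k A) (diagAct k f.dom) (f.lin k)
      (mulMap k f.dom) (mulMap_diagAct k f.dom) h (x ⊗ₜ a)
    rw [← e, mulMap_tmul] at e1
    exact e1.symm
  · intro h
    ext x a
    have key : ∀ X : H ⊗[k] H, pairRight (diagAct k f.dom) (tailMul k (actLin k f)) X (x ⊗ₜ a) =
        LinearMap.mul' k A (TensorProduct.map ((LinearMap.applyₗ x) ∘ₗ pairRight (f.dom.act k) (actLin k f))
          (orbitMap k a) ((TensorProduct.assoc k H H H).symm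
            (TensorProduct.map LinearMap.id comul X))) := by
      intro X
      induction X using TensorProduct.induction_on with
      | zero => simp
      | add s t hs ht => simp only [map_add, LinearMap.add_apply, hs, ht]
      | tmul p q =>
        rw [pairRight_tmul, TensorProduct.map_tmul, LinearMap.comp_apply]
        change tailMul k (actLin k f) p (Module.endTensorEndAlgHom (Algebra.TensorProduct.map
          (f.dom.act k) (Algebra.lsmul k k A) (comul q)) (x ⊗ₜ a)) = _
        induction (comul (R := k) q) using TensorProduct.induction_on with
        | zero => simp
        | add s t hs ht => simp only [map_add, LinearMap.add_apply, TensorProduct.tmul_add, hs, ht]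
        | tmul r s =>
          simp only [LinearMap.id_coe, id_eq, TensorProduct.assoc_symm_tmul, TensorProduct.map_tmul,
            LinearMap.comp_apply, pairRight_tmul]
          rfl
    have e1 := coassoc_symm_apply (R := k) h
    rw [LinearMap.rTensor, LinearMap.lTensor] at e1
    have e2 : ∀ X : H ⊗[k] H, TensorProduct.map ((LinearMap.applyₗ x) ∘ₗ
        pairRight (f.dom.act k) (actLin k f)) (orbitMap k a) (TensorProduct.map comul LinearMap.id X) =
        TensorProduct.map (orbitMap k (f.map x)) (orbitMap k a) X := by
      intro X
      induction X using TensorProduct.induction_on with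
      | zero => simp
      | add s t hs ht => simp only [map_add, hs, ht]
      | tmul p q =>
        simp only [TensorProduct.map_tmul, LinearMap.comp_apply, sum_actLin]
        rfl
    change pairRight (diagAct k f.dom) (tailMul k (actLin k f)) (comul h) (x ⊗ₜ a) =
      h • f.map ⟨x.1 * a, _⟩
    rw [key, e1, e2, map_mul_right f x a, HModuleAlgebra.smul_mul (k := k)]

/-- Cohen's action: `(h • f)(x) = ∑ h₁ • f (S(h₂) • x)`. -/
noncomputable def hact (h : H) (f : PartialHom H A) : PartialHom H A where
  dom := f.dom
  faithful := f.faithful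
  map :=
    { toFun := actLin k f h
      map_add' := (actLin k f h).map_add
      map_smul' := fun a x => actLin_mul_right k f h x a.unop }

theorem actLin_congr (f g : PartialHom H A) (K : HIdeal H A)
    (hf : K.toSubmodule ≤ f.dom.toSubmodule) (hg : K.toSubmodule ≤ g.dom.toSubmodule)
    (hfg : ∀ x (hx : x ∈ K.toSubmodule), f.map ⟨x, hf hx⟩ = g.map ⟨x, hg hx⟩) (h : H)
    (x : A) (hx : x ∈ K.toSubmodule) :
    actLin k f h ⟨x, hf hx⟩ = actLin k g h ⟨x, hg hx⟩ := by
  have e1 := adjAct_comp (f.dom.act k) (Algebra.lsmul k k A) (K.act k) (f.lin k)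
    ((Submodule.inclusion hf).restrictScalars k) (fun _ => rfl) h ⟨x, hx⟩
  have e2 := adjAct_comp (g.dom.act k) (Algebra.lsmul k k A) (K.act k) (g.lin k)
    ((Submodule.inclusion hg).restrictScalars k) (fun _ => rfl) h ⟨x, hx⟩
  have e3 : f.lin k ∘ₗ (Submodule.inclusion hf).restrictScalars k =
      g.lin k ∘ₗ (Submodule.inclusion hg).restrictScalars k := by
    ext y
    exact hfg y.1 y.2
  rw [e3, e2] at e1
  exact e1.symm

end PartialHom

/-- The right Martindale quotient ring `Q₀(A)` of an `H`-module algebra: classes `[f : I → A]` of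
right `A`-linear maps defined on `H`-stable ideals `I` with zero left and right annihilator. -/
def MartindaleQuotient (k : Type u) (H : Type v) (A : Type w) [CommRing k] [Ring H]
    [HopfAlgebra k H] [Ring A] [Algebra k A] [Module H A] [IsScalarTower k H A]
    [HModuleAlgebra k H A] : Type w :=
  Quotient (PartialHom.setoid k H A)

namespace MartindaleQuotient

variable {k : Type u} {H : Type v} {A : Type w} [CommRing k] [Ring H] [HopfAlgebra k H] [Ring A]
  [Algebra k A] [Module H A] [IsScalarTower k H A] [HModuleAlgebra k H A]

variable (k) in
/-- The class `[f : I → A]`. -/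
def mk (f : PartialHom H A) : MartindaleQuotient k H A := Quotient.mk (PartialHom.setoid k H A) f

theorem sound {f g : PartialHom H A} (K : HIdeal H A) (hK : K.Faithful)
    (hf : K.toSubmodule ≤ f.dom.toSubmodule) (hg : K.toSubmodule ≤ g.dom.toSubmodule)
    (h : ∀ x (hx : x ∈ K.toSubmodule), f.map ⟨x, hf hx⟩ = g.map ⟨x, hg hx⟩) :
    mk k f = mk k g :=
  Quotient.sound (s := PartialHom.setoid k H A) ⟨K, hK, hf, hg, h⟩

theorem mk_surjective (q : MartindaleQuotient k H A) : ∃ f, mk k f = q :=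
  Quotient.exists_rep q

instance : Zero (MartindaleQuotient k H A) := ⟨mk k (PartialHom.left H 0)⟩
instance : One (MartindaleQuotient k H A) := ⟨mk k (PartialHom.left H 1)⟩

instance : Add (MartindaleQuotient k H A) :=
  ⟨Quotient.map₂ (PartialHom.add k) fun _ _ ⟨K, hK, hf, hf', h⟩ _ _ ⟨L, hL, hg, hg', h'⟩ =>
    ⟨K.inf L, HIdeal.inf_faithful k hK hL, fun _ hx => ⟨hf hx.1, hg hx.2⟩,
      fun _ hx => ⟨hf' hx.1, hg' hx.2⟩, fun x hx => congrArg₂ (· + ·) (h x hx.1) (h' x hx.2)⟩⟩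

instance : Neg (MartindaleQuotient k H A) :=
  ⟨Quotient.map PartialHom.neg fun _ _ ⟨K, hK, hf, hf', h⟩ =>
    ⟨K, hK, hf, hf', fun x hx => congrArg (- ·) (h x hx)⟩⟩

instance : Mul (MartindaleQuotient k H A) :=
  ⟨Quotient.map₂ (PartialHom.mul k) fun f f' ⟨K, hK, hf, hf', h⟩ g g' ⟨L, hL, hg, hg', h'⟩ => by
    have hle : (HIdeal.mul k L K).toSubmodule ≤ (HIdeal.mul k g.dom f.dom).toSubmodule :=
      HIdeal.mul_le k _ _ _ fun x hx y hy => HIdeal.mul_mem_mul k _ _ (hg hx) (hf hy)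
    have hle' : (HIdeal.mul k L K).toSubmodule ≤ (HIdeal.mul k g'.dom f'.dom).toSubmodule :=
      HIdeal.mul_le k _ _ _ fun x hx y hy => HIdeal.mul_mem_mul k _ _ (hg' hx) (hf' hy)
    refine ⟨HIdeal.mul k L K, HIdeal.mul_faithful k hL hK, hle, hle', fun x hx => ?_⟩
    have hx' := HIdeal.mul_le_left k _ _ hx
    have e := h' x hx'
    have hm : g.map ⟨x, hg hx'⟩ ∈ K.toSubmodule :=
      PartialHom.map_mem k ⟨L, hL, g.map ∘ₗ Submodule.inclusion hg⟩ K hx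
    refine (h _ hm).trans ?_
    change f'.map _ = f'.map _
    congr 1
    exact Subtype.ext e⟩

theorem mk_add (f g : PartialHom H A) : mk k f + mk k g = mk k (f.add k g) := rfl
theorem mk_mul (f g : PartialHom H A) : mk k f * mk k g = mk k (f.mul k g) := rfl

theorem add_assoc' (a b c : MartindaleQuotient k H A) : a + b + c = a + (b + c) := by
  obtain ⟨f, rfl⟩ := mk_surjective a
  obtain ⟨g, rfl⟩ := mk_surjective b
  obtain ⟨l, rfl⟩ := mk_surjective c
  exact sound (f := (f.add k g).add k l) (g := f.add k (g.add k l)) ((f.add k g).add k l).dom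
    ((f.add k g).add k l).faithful le_rfl
    (fun x hx => ⟨hx.1.1, hx.1.2, hx.2⟩) fun x hx => add_assoc _ _ _

theorem zero_add' (a : MartindaleQuotient k H A) : 0 + a = a := by
  obtain ⟨f, rfl⟩ := mk_surjective a
  refine sound (f := (PartialHom.left H 0).add k f) f.dom f.faithful
    (fun x hx => ⟨trivial, hx⟩) le_rfl fun x hx => ?_
  change 0 * x + f.map ⟨x, hx⟩ = _
  simp

theorem neg_add_cancel' (a : MartindaleQuotient k H A) : -a + a = 0 := by
  obtain ⟨f, rfl⟩ := mk_surjective a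
  refine sound (f := f.neg.add k f) (g := PartialHom.left H 0) f.dom f.faithful
    (fun x hx => ⟨hx, hx⟩) (fun x hx => trivial) fun x hx => ?_
  change - f.map ⟨x, hx⟩ + f.map ⟨x, hx⟩ = 0 * x
  simp

theorem add_comm' (a b : MartindaleQuotient k H A) : a + b = b + a := by
  obtain ⟨f, rfl⟩ := mk_surjective a
  obtain ⟨g, rfl⟩ := mk_surjective b
  exact sound (f := f.add k g) (g := g.add k f) (f.add k g).dom (f.add k g).faithful le_rfl
    (fun x hx => ⟨hx.2, hx.1⟩) fun x hx => add_comm _ _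

instance : AddCommGroup (MartindaleQuotient k H A) :=
  { AddGroup.ofLeftAxioms add_assoc' zero_add' neg_add_cancel' with add_comm := add_comm' }

theorem left_distrib' (a b c : MartindaleQuotient k H A) : a * (b + c) = a * b + a * c := by
  obtain ⟨f, rfl⟩ := mk_surjective a
  obtain ⟨g, rfl⟩ := mk_surjective b
  obtain ⟨l, rfl⟩ := mk_surjective c
  refine sound _ (HIdeal.inf_faithful k (f.mul k (g.add k l)).faithful
    ((f.mul k g).add k (f.mul k l)).faithful) (fun x hx => hx.1) (fun x hx => hx.2)
    fun x hx => ?_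
  exact f.map.map_add ⟨g.map ⟨x, HIdeal.mul_le_left k _ _ hx.2.1⟩, PartialHom.map_mem k g _ hx.2.1⟩
    ⟨l.map ⟨x, HIdeal.mul_le_left k _ _ hx.2.2⟩, PartialHom.map_mem k l _ hx.2.2⟩

theorem right_distrib' (a b c : MartindaleQuotient k H A) : (a + b) * c = a * c + b * c := by
  obtain ⟨f, rfl⟩ := mk_surjective a
  obtain ⟨g, rfl⟩ := mk_surjective b
  obtain ⟨l, rfl⟩ := mk_surjective c
  exact sound _ (HIdeal.inf_faithful k ((f.add k g).mul k l).faithful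
    ((f.mul k l).add k (g.mul k l)).faithful) (fun x hx => hx.1) (fun x hx => hx.2)
    fun x hx => rfl

theorem mul_assoc' (a b c : MartindaleQuotient k H A) : a * b * c = a * (b * c) := by
  obtain ⟨f, rfl⟩ := mk_surjective a
  obtain ⟨g, rfl⟩ := mk_surjective b
  obtain ⟨l, rfl⟩ := mk_surjective c
  exact sound _ (HIdeal.inf_faithful k ((f.mul k g).mul k l).faithful
    (f.mul k (g.mul k l)).faithful) (fun x hx => hx.1) (fun x hx => hx.2)
    fun x hx => rfl

instance : Ring (MartindaleQuotient k H A) :=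
  { (inferInstance : AddCommGroup (MartindaleQuotient k H A)),
    (inferInstance : Mul (MartindaleQuotient k H A)),
    (inferInstance : One (MartindaleQuotient k H A)) with
    left_distrib := fun a b c => left_distrib' a b c
    right_distrib := fun a b c => right_distrib' a b c
    zero_mul := fun a => by
      have h := right_distrib' (0 : MartindaleQuotient k H A) 0 a
      rw [zero_add'] at h
      exact left_eq_add.mp h
    mul_zero := fun a => by
      have h := left_distrib' a (0 : MartindaleQuotient k H A) 0
      rw [zero_add'] at h
      exact left_eq_add.mp h
    mul_assoc := fun a b c => mul_assoc' a b c
    one_mul := fun a => by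
      obtain ⟨f, rfl⟩ := mk_surjective a
      refine sound _ ((PartialHom.left H 1).mul k f).faithful le_rfl
        (HIdeal.mul_le_left k _ _) fun x hx => ?_
      exact one_mul (f.map ⟨x, _⟩)
    mul_one := fun a => by
      obtain ⟨f, rfl⟩ := mk_surjective a
      refine sound _ (f.mul k (PartialHom.left H 1)).faithful le_rfl
        (HIdeal.mul_le_right k _ _) fun x hx => ?_
      change f.map ⟨1 * x, _⟩ = _
      congr 1
      exact Subtype.ext (one_mul x) }

variable (k H A) in
/-- The embedding `ι : A → Q₀`, `a ↦ [L_a : A → A]`. -/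
def incl : A →+* MartindaleQuotient k H A where
  toFun a := mk k (PartialHom.left H a)
  map_one' := rfl
  map_zero' := rfl
  map_add' a b := sound (f := PartialHom.left H (a + b))
    (g := (PartialHom.left H a).add k (PartialHom.left H b)) HIdeal.top HIdeal.top_faithful le_rfl (fun _ _ => ⟨trivial, trivial⟩)
    fun x _ => add_mul a b x
  map_mul' a b := sound (f := PartialHom.left H (a * b))
    (g := (PartialHom.left H a).mul k (PartialHom.left H b)) _
    ((PartialHom.left H a).mul k (PartialHom.left H b)).faithful
    (fun _ _ => trivial) le_rfl fun x _ => mul_assoc a b x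

theorem incl_algebraMap_commutes (c : k) (q : MartindaleQuotient k H A) :
    incl k H A (algebraMap k A c) * q = q * incl k H A (algebraMap k A c) := by
  obtain ⟨f, rfl⟩ := mk_surjective q
  refine sound (f := (PartialHom.left H (algebraMap k A c)).mul k f)
    (g := f.mul k (PartialHom.left H (algebraMap k A c))) _
    (HIdeal.inf_faithful k ((PartialHom.left H (algebraMap k A c)).mul k f).faithful
    (f.mul k (PartialHom.left H (algebraMap k A c))).faithful) (fun x hx => hx.1)
    (fun x hx => hx.2) fun x hx => ?_
  have hx' : x ∈ f.dom.toSubmodule := HIdeal.mul_le_left k _ _ hx.1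
  change algebraMap k A c * f.map ⟨x, _⟩ = f.map ⟨algebraMap k A c * x, _⟩
  have := PartialHom.map_mul_right f ⟨x, hx'⟩ (algebraMap k A c)
  rw [Algebra.commutes, ← this]
  congr 1
  exact Subtype.ext (Algebra.commutes c x).symm

instance : Algebra k (MartindaleQuotient k H A) :=
  ((incl k H A).comp (algebraMap k A)).toAlgebra' fun c q => incl_algebraMap_commutes c q

/-- The embedding of `A` as a homomorphism of `k`-algebras. -/
def inclAlg : A →ₐ[k] MartindaleQuotient k H A := { incl k H A with commutes' := fun _ => rfl }

theorem smul_mk (c : k) (f : PartialHom H A) :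
    c • mk k f = mk k ⟨f.dom, f.faithful, c • f.map⟩ := by
  refine sound (f := (PartialHom.left H (algebraMap k A c)).mul k f)
    (g := ⟨f.dom, f.faithful, c • f.map⟩) _
    ((PartialHom.left H (algebraMap k A c)).mul k f).faithful le_rfl
    (HIdeal.mul_le_left k _ _) fun x hx => ?_
  exact (Algebra.smul_def c _).symm

/-- The action of `h` on `Q₀`. -/
noncomputable instance : SMul H (MartindaleQuotient k H A) :=
  ⟨fun h => Quotient.map (PartialHom.hact k h) fun f g ⟨K, hK, hf, hg, e⟩ =>
    ⟨K, hK, hf, hg, PartialHom.actLin_congr k f g K hf hg e h⟩⟩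

theorem hsmul_mk (h : H) (f : PartialHom H A) : h • mk k f = mk k (f.hact k h) := rfl

noncomputable instance : Module H (MartindaleQuotient k H A) where
  one_smul q := by
    obtain ⟨f, rfl⟩ := mk_surjective q
    refine sound f.dom f.faithful le_rfl le_rfl fun x hx => ?_
    exact LinearMap.congr_fun (adjAct_one (f.dom.act k) (Algebra.lsmul k k A) (f.lin k)) ⟨x, hx⟩
  mul_smul h g q := by
    obtain ⟨f, rfl⟩ := mk_surjective q
    refine sound f.dom f.faithful le_rfl le_rfl fun x hx => ?_
    exact LinearMap.congr_fun (adjAct_mul (f.dom.act k) (Algebra.lsmul k k A) (f.lin k) h g) ⟨x, hx⟩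
  smul_zero h := by
    refine sound (f := (PartialHom.left H 0).hact k h) (g := PartialHom.left H 0) HIdeal.top
      HIdeal.top_faithful le_rfl le_rfl fun x hx => ?_
    have e : (PartialHom.left H (0 : A)).lin k = 0 := by
      ext x
      exact zero_mul x.1
    change adjAct _ _ ((PartialHom.left H (0 : A)).lin k) h ⟨x, hx⟩ = 0 * x
    rw [e, adjAct_zero, zero_mul]
    rfl
  smul_add h p q := by
    obtain ⟨f, rfl⟩ := mk_surjective p
    obtain ⟨g, rfl⟩ := mk_surjective q
    refine sound (f := (f.add k g).hact k h) (g := (f.hact k h).add k (g.hact k h))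
      (f.add k g).dom (f.add k g).faithful le_rfl le_rfl fun x hx => ?_
    have hl : (f.dom.inf g.dom).toSubmodule ≤ f.dom.toSubmodule := inf_le_left
    have hr : (f.dom.inf g.dom).toSubmodule ≤ g.dom.toSubmodule := inf_le_right
    have e1 := adjAct_comp (f.dom.act k) (Algebra.lsmul k k A) ((f.dom.inf g.dom).act k) (f.lin k)
      ((Submodule.inclusion hl).restrictScalars k) (fun _ => rfl) h ⟨x, hx⟩
    have e2 := adjAct_comp (g.dom.act k) (Algebra.lsmul k k A) ((f.dom.inf g.dom).act k) (g.lin k)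
      ((Submodule.inclusion hr).restrictScalars k) (fun _ => rfl) h ⟨x, hx⟩
    change adjAct ((f.dom.inf g.dom).act k) _ (f.lin k ∘ₗ (Submodule.inclusion hl).restrictScalars k +
      g.lin k ∘ₗ (Submodule.inclusion hr).restrictScalars k) h ⟨x, hx⟩ = _
    rw [adjAct_add, LinearMap.add_apply, LinearMap.add_apply, e1, e2]
    rfl
  add_smul h g q := by
    obtain ⟨f, rfl⟩ := mk_surjective q
    refine sound (f := f.hact k (h + g)) (g := (f.hact k h).add k (f.hact k g)) f.dom
      f.faithful le_rfl (fun x hx => ⟨hx, hx⟩) fun x hx => ?_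
    exact LinearMap.congr_fun ((PartialHom.actLin k f).map_add h g) ⟨x, hx⟩
  zero_smul q := by
    obtain ⟨f, rfl⟩ := mk_surjective q
    refine sound (f := f.hact k 0) (g := PartialHom.left H 0) f.dom
      f.faithful le_rfl (fun x hx => trivial) fun x hx => ?_
    refine (LinearMap.congr_fun ((PartialHom.actLin k f).map_zero) ⟨x, hx⟩).trans ?_
    exact (zero_mul x).symm

instance : IsScalarTower k H (MartindaleQuotient k H A) where
  smul_assoc c h q := by
    obtain ⟨f, rfl⟩ := mk_surjective q
    rw [hsmul_mk, hsmul_mk, smul_mk]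
    refine sound f.dom f.faithful le_rfl le_rfl fun x hx => ?_
    exact LinearMap.congr_fun ((PartialHom.actLin k f).map_smul c h) ⟨x, hx⟩

/-- The class map restricted to a fixed domain, as an additive map. -/
def mkOn (I : HIdeal H A) (hI : I.Faithful) :
    (I.toSubmodule →ₗ[Aᵐᵒᵖ] A) →+ MartindaleQuotient k H A where
  toFun f := mk k ⟨I, hI, f⟩
  map_zero' := sound (f := ⟨I, hI, 0⟩) (g := PartialHom.left H 0) I hI le_rfl (fun _ _ => trivial) fun x _ => (zero_mul x).symm
  map_add' f g := sound (f := ⟨I, hI, f + g⟩)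
    (g := PartialHom.add k ⟨I, hI, f⟩ ⟨I, hI, g⟩) I hI le_rfl (fun _ hx => ⟨hx, hx⟩) fun _ _ => rfl


section ModuleAlgebra

variable (f g : PartialHom H A)

theorem actLin_mem (q : H) (x : (HIdeal.mul k g.dom f.dom).toSubmodule) :
    PartialHom.actLin k g q ⟨x.1, HIdeal.mul_le_left k _ _ x.2⟩ ∈ f.dom.toSubmodule :=
  PartialHom.map_mem k (g.hact k q) f.dom x.2

/-- `q ↦ (x ↦ (q • g)(x))` on the product ideal, with values in the domain of `f`. -/
noncomputable def actRestrict :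
    H →ₗ[k] ((HIdeal.mul k g.dom f.dom).toSubmodule →ₗ[k] f.dom.toSubmodule) where
  toFun q :=
    { toFun := fun x => ⟨_, actLin_mem f g q x⟩
      map_add' := fun x y => Subtype.ext ((PartialHom.actLin k g q).map_add
        ⟨x.1, HIdeal.mul_le_left k _ _ x.2⟩ ⟨y.1, HIdeal.mul_le_left k _ _ y.2⟩)
      map_smul' := fun c x => Subtype.ext ((PartialHom.actLin k g q).map_smul c
        ⟨x.1, HIdeal.mul_le_left k _ _ x.2⟩) }
  map_add' p q := by
    ext x
    exact LinearMap.congr_fun ((PartialHom.actLin k g).map_add p q) _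
  map_smul' c q := by
    ext x
    exact LinearMap.congr_fun ((PartialHom.actLin k g).map_smul c q) _

/-- `p ⊗ q ↦ (p • f) ∘ (q • g)` on the product ideal. -/
noncomputable def actComp : H ⊗[k] H →ₗ[k] ((HIdeal.mul k g.dom f.dom).toSubmodule →ₗ[k] A) :=
  TensorProduct.lift <| LinearMap.mk₂ k
    (fun p q => PartialHom.actLin k f p ∘ₗ actRestrict f g q)
    (fun p p' q => by ext; simp) (fun c p q => by ext; simp)
    (fun p q q' => by ext; simp) (fun c p q => by ext; simp)

theorem actComp_tmul (p q : H) :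
    actComp (k := k) f g (p ⊗ₜ q) = PartialHom.actLin k f p ∘ₗ actRestrict f g q := by
  simp [actComp]

theorem sum_actRestrict (q : H) (x : (HIdeal.mul k g.dom f.dom).toSubmodule) :
    pairRight ((HIdeal.mul k g.dom f.dom).act k) (actRestrict f g) (comul q) x =
      f.dom.act k q ⟨_, PartialHom.map_mem k g f.dom x.2⟩ := by
  apply Subtype.ext
  have e := LinearMap.congr_fun (PartialHom.sum_actLin k g q) ⟨x.1, HIdeal.mul_le_left k _ _ x.2⟩
  refine Eq.trans ?_ e
  induction (comul (R := k) q) using TensorProduct.induction_on with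
  | zero => simp
  | add s t hs ht => simp only [map_add, LinearMap.add_apply, Submodule.coe_add, hs, ht]
  | tmul p q => simp only [pairRight_tmul]; rfl

theorem actComp_comul (h : H) :
    actComp (k := k) f g (comul h) = PartialHom.actLin k (f.mul k g) h := by
  have e : actComp (k := k) f g ∘ₗ comul = PartialHom.actLin k (f.mul k g) := by
    refine adjAct_unique ((HIdeal.mul k g.dom f.dom).act k) (Algebra.lsmul k k A)
      ((f.mul k g).lin k) _ fun h => ?_
    ext x
    have key : ∀ X : H ⊗[k] H,
        pairRight ((HIdeal.mul k g.dom f.dom).act k) (actComp (k := k) f g ∘ₗ comul) X x =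
        TensorProduct.lift ((PartialHom.actLin k f).compl₂ ((LinearMap.applyₗ x) ∘ₗ
          pairRight ((HIdeal.mul k g.dom f.dom).act k) (actRestrict f g)))
          (TensorProduct.assoc k H H H (TensorProduct.map comul LinearMap.id X)) := by
      intro X
      induction X using TensorProduct.induction_on with
      | zero => simp
      | add s t hs ht => simp only [map_add, LinearMap.add_apply, hs, ht]
      | tmul p q =>
        rw [pairRight_tmul, LinearMap.comp_apply, LinearMap.comp_apply, TensorProduct.map_tmul]
        induction (comul (R := k) p) using TensorProduct.induction_on with
        | zero => simp
        | add s t hs ht =>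
          simp only [map_add, LinearMap.add_apply, TensorProduct.add_tmul, hs, ht]
        | tmul r s => simp [actComp_tmul, pairRight_tmul]
    have key2 : ∀ X : H ⊗[k] H,
        TensorProduct.lift ((PartialHom.actLin k f).compl₂ ((LinearMap.applyₗ x) ∘ₗ
          pairRight ((HIdeal.mul k g.dom f.dom).act k) (actRestrict f g)))
          (TensorProduct.map LinearMap.id comul X) =
        pairRight (f.dom.act k) (PartialHom.actLin k f) X
          ⟨_, PartialHom.map_mem k g f.dom x.2⟩ := by
      intro X
      induction X using TensorProduct.induction_on with
      | zero => simp
      | add s t hs ht => simp only [map_add, LinearMap.add_apply, hs, ht]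
      | tmul p q =>
        simp [pairRight_tmul, sum_actRestrict]
    have e1 := coassoc_apply (R := k) h
    rw [LinearMap.rTensor, LinearMap.lTensor] at e1
    rw [key, e1, key2, PartialHom.sum_actLin]
    rfl
  exact LinearMap.congr_fun e h

theorem exists_mkOn (X : H ⊗[k] H) :
    ∃ φ : (HIdeal.mul k g.dom f.dom).toSubmodule →ₗ[Aᵐᵒᵖ] A,
      LinearMap.mul' k (MartindaleQuotient k H A)
        (TensorProduct.map (orbitMap k (mk k f)) (orbitMap k (mk k g)) X) =
        mkOn (HIdeal.mul k g.dom f.dom) (HIdeal.mul_faithful k g.faithful f.faithful) φ ∧ ∀ x, φ x = actComp f g X x := by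
  induction X using TensorProduct.induction_on with
  | zero => exact ⟨0, by simp, by simp⟩
  | add s t hs ht =>
    obtain ⟨φ, h₁, h₂⟩ := hs
    obtain ⟨ψ, h₃, h₄⟩ := ht
    exact ⟨φ + ψ, by simp only [map_add, h₁, h₃], fun x => by simp [h₂, h₄]⟩
  | tmul p q =>
    refine ⟨((f.hact k p).mul k (g.hact k q)).map, rfl, fun x => ?_⟩
    rw [actComp_tmul]
    rfl

end ModuleAlgebra

instance : HModuleAlgebra k H (MartindaleQuotient k H A) where
  smul_one h := by
    refine sound (f := (PartialHom.left H 1).hact k h)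
      (g := PartialHom.left H (algebraMap k A (counit h))) HIdeal.top HIdeal.top_faithful le_rfl
      le_rfl fun x hx => ?_
    have key : ∀ X : H ⊗[k] H, adjPair ((PartialHom.left H (1 : A)).dom.act k)
        (Algebra.lsmul k k A) ((PartialHom.left H 1).lin k) X ⟨x, hx⟩ =
        (LinearMap.mul' k H (LinearMap.lTensor H (HopfAlgebra.antipode k) X)) • x := by
      intro X
      induction X using TensorProduct.induction_on with
      | zero => simp
      | add s t hs ht => simp only [map_add, LinearMap.add_apply, hs, ht, add_smul]
      | tmul p q =>
        rw [adjPair_tmul]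
        change p • (1 * (HopfAlgebra.antipode k q • x)) = (p * HopfAlgebra.antipode k q) • x
        rw [one_mul, mul_smul]
    refine (key (comul h)).trans ?_
    rw [HopfAlgebra.mul_antipode_lTensor_comul_apply, algebraMap_smul, Algebra.smul_def]
    rfl
  smul_mul h p q := by
    obtain ⟨f, rfl⟩ := mk_surjective p
    obtain ⟨g, rfl⟩ := mk_surjective q
    obtain ⟨φ, h₁, h₂⟩ := exists_mkOn f g (comul (R := k) h)
    rw [h₁]
    refine sound (f := (f.mul k g).hact k h) (g := ⟨_, (f.mul k g).faithful, φ⟩)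
      (f.mul k g).dom (f.mul k g).faithful le_rfl le_rfl fun x hx => ?_
    refine Eq.trans ?_ (h₂ ⟨x, hx⟩).symm
    rw [actComp_comul]
    rfl

end MartindaleQuotient

/-- `Z(C)^H`: the central `H`-invariant elements of an `H`-module algebra `C`. -/
def centralInvariants (k H C : Type*) [CommRing k] [Ring H] [HopfAlgebra k H] [Ring C]
    [Algebra k C] [Module H C] [IsScalarTower k H C] [HModuleAlgebra k H C] : Subalgebra k C where
  carrier := {z | (∀ x : C, z * x = x * z) ∧ ∀ h : H, h • z = counit (R := k) h • z}
  mul_mem' := by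
    rintro y z ⟨hy, hy'⟩ ⟨hz, hz'⟩
    refine ⟨fun x => by rw [mul_assoc, hz, ← mul_assoc, hy, mul_assoc], fun h => ?_⟩
    have key : ∀ X : H ⊗[k] H, LinearMap.mul' k C
        (TensorProduct.map (orbitMap k y) (orbitMap k z) X) =
        counit (R := k) (TensorProduct.lid k H (LinearMap.rTensor H (counit (R := k)) X)) •
          (y * z) := by
      intro X
      induction X using TensorProduct.induction_on with
      | zero => simp
      | add s t hs ht => simp only [map_add, hs, ht, add_smul]
      | tmul p q =>
        have e1 : orbitMap k y p = p • y := rfl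
        have e2 : orbitMap k z q = q • z := rfl
        simp [e1, e2, hy', hz', smul_smul, mul_comm]
    rw [HModuleAlgebra.smul_mul (k := k), key, rTensor_counit_comul]
    simp
  add_mem' := by
    rintro y z ⟨hy, hy'⟩ ⟨hz, hz'⟩
    exact ⟨fun x => by rw [add_mul, mul_add, hy, hz], fun h => by rw [smul_add, smul_add, hy', hz']⟩
  algebraMap_mem' c := by
    refine ⟨fun x => Algebra.commutes c x, fun h => ?_⟩
    rw [Algebra.algebraMap_eq_smul_one, smul_comm, HModuleAlgebra.smul_one (k := k),
      Algebra.algebraMap_eq_smul_one, smul_comm]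

/-- `A` is `H`-semiprime: it has no nonzero `H`-stable two-sided ideal of square zero. -/
def IsHSemiprime (H A : Type*) [Ring H] [Ring A] [Module H A] : Prop :=
  ∀ K : HIdeal H A, (∀ x ∈ K.toSubmodule, ∀ y ∈ K.toSubmodule, x * y = 0) →
    K.toSubmodule = ⊥

/-- `A` is semiprime: it has no nonzero two-sided ideal of square zero. -/
def IsSemiprimeAlgebra (A : Type*) [Ring A] : Prop :=
  ∀ K : TwoSidedIdeal A, (∀ x ∈ K, ∀ y ∈ K, x * y = 0) → K = ⊥

/-- A ring is von Neumann regular if every `x` satisfies `x = x y x` for some `y`. -/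
def IsVonNeumannRegular (C : Type*) [Ring C] : Prop := ∀ x : C, ∃ y : C, x = x * y * x

section Hull

variable {R M E : Type*} [Ring R] [AddCommGroup M] [Module R M] [AddCommGroup E] [Module R E]

/-- `i : M → E` is an injective hull: `E` is an injective `R`-module and `i` is a monomorphism with
essential image. -/
structure IsInjectiveHull (i : M →ₗ[R] E) : Prop where
  injective : Function.Injective i
  essential : ∀ N : Submodule R E, N ⊓ LinearMap.range i = ⊥ → N = ⊥
  injective_module : Module.Injective R E

/-- The self-injective hull of `M`: the largest `M`-generated submodule of the injective hull `E`
of `M`, i.e. the sum of the images of all homomorphisms `M → E`. -/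
def selfInjectiveHull (R M E : Type*) [Ring R] [AddCommGroup M] [Module R M] [AddCommGroup E]
    [Module R E] : Submodule R E :=
  ⨆ f : M →ₗ[R] E, LinearMap.range f

/-- The map of `M` into its self-injective hull. -/
def toSelfInjectiveHull (i : M →ₗ[R] E) : M →ₗ[R] selfInjectiveHull R M E :=
  LinearMap.codRestrict _ i fun x =>
    (le_iSup (fun f : M →ₗ[R] E => LinearMap.range f) i) ⟨x, rfl⟩

end Hull

/-- `e` identifies the self-injective hull `Â` of `A` as an `A^e #_ν H`-module (inside an injective
hull `i : A → E`) with the `H`-module algebra `C`, where `A → C` is unital, the product is the one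
of the central closure, `(a s) (b t) = (a b) (s t)` for `a, b ∈ A` and endomorphisms `s, t` of `Â`,
and `h` acts on `C` as `(1 ⊗ 1) # h` acts on `Â`. As `Â` is spanned by the elements `a s`, this
determines the product and the `H`-action completely. -/
structure IsCentralClosure {k : Type u} {H : Type v} {A : Type w} [CommRing k] [Ring H]
    [HopfAlgebra k H] [Ring A] [Algebra k A] [Module H A] [IsScalarTower k H A]
    [HModuleAlgebra k H A] {E : Type*} [AddCommGroup E] [Module k E]
    [Module (SmashEnv k H A) E] [IsScalarTower k (SmashEnv k H A) E]
    (i : A →ₗ[SmashEnv k H A] E) {C : Type*} [Ring C] [Algebra k C] [Module H C]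
    (e : selfInjectiveHull (SmashEnv k H A) A E ≃ₗ[k] C) : Prop where
  map_one : e (toSelfInjectiveHull i 1) = 1
  map_mul : ∀ (a b : A) (s t : Module.End (SmashEnv k H A) (selfInjectiveHull (SmashEnv k H A) A E)),
    e (s (toSelfInjectiveHull i a)) * e (t (toSelfInjectiveHull i b)) =
      e ((s * t) (toSelfInjectiveHull i (a * b)))
  map_hsmul : ∀ (h : H) (x : selfInjectiveHull (SmashEnv k H A) A E),
    h • e x = e (SmashEnv.mk (k := k) (1 : A) 1 h • x)

/-! Write B for the smash product, Q₀ for the Martindale quotient ring and Â for the self-injective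
hull. The B-submodules of A are its H-stable ideals, and a B-endomorphism of Â commutes with H and
with both multiplications by A. The theorem compares two kinds of maps: partial maps on large ideals
of A, and endomorphisms of Â.

Large ideals. For an H-stable ideal I, the elements m of a B-module with m I = 0 form a B-submodule
`leftAnn`, because (h·m)x = Σ h₁·(m(S(h₂)·x)). By H-semiprimeness it meets I trivially inside A, so
essential ideals have zero left annihilator; each of (i), (ii), (iii) carries this over to the right
annihilator (`HIdeal.faithful_of_left`). Thus essential ideals are faithful. Conversely a faithful
ideal annihilates no nonzero element of E, since its annihilator in E would meet A
(`HIdeal.eq_zero_of_right_smul`).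

Embedding. Â is spanned by the elements s(a) with s in T, and s maps the essential ideal I_s =
s⁻¹(A) ∩ A into A. So every γ in Â acts by left multiplication as a partial map, and γ ↦ [L_γ]
embeds Â in Q₀. The partial map of an endomorphism is left linear and H-linear, so its class is a
central invariant. Conversely an invariant class commuting with A is given by a B-linear map I → A,
which extends to E by injectivity and restricts to the fully invariant Â. Hence T ≅ Z(Q₀)^H. The
product of Â is the one pulled back from Q₀.

Ring properties. An s in T is injective on the annihilator of K = A ∩ ker s; if t inverts it there,
then s t s = s on the essential ideal K + leftAnn K, hence everywhere. For self-injectivity, a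
linear map φ on an ideal J gives two maps from ⊕_J A to Â, with components z and φ(z); common units
in J show that the second factors through the first, and the factor extends to an endomorphism t
with t z = φ(z). -/

namespace SmashEnv

/-! ### Generators of the smash product -/

section Generators
variable {k : Type u} {H : Type v} {A : Type w} [CommRing k] [Ring H] [HopfAlgebra k H] [Ring A]
  [Algebra k A] [Module H A] [IsScalarTower k H A] [HModuleAlgebra k H A]

theorem mk_induction {P : SmashEnv k H A → Prop} (h0 : P 0) (ht : ∀ a b h, P (mk a b h))
    (ha : ∀ x y, P x → P y → P (x + y)) (x : SmashEnv k H A) : P x :=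
  envInduction (P := P) h0 (fun a b h => ht a b.unop h) ha x

theorem lmulSmash_tmul_one (x : A ⊗[k] Aᵐᵒᵖ) (y : A ⊗[k] Aᵐᵒᵖ) (g : H) :
    lmulSmash k H A (x ⊗ₜ 1) (y ⊗ₜ g) = (x * y) ⊗ₜ g := by
  rw [lmulSmash_tmul, map_one, map_one, mul_one, leftEnv_tmul]

theorem mk_one_mul_mk (a b a' b' : A) (g : H) :
    mk (k := k) a b (1 : H) * mk a' b' g = mk (a * a') (b' * b) g :=
  (lmulSmash_tmul_one (k := k) (H := H) (a ⊗ₜ MulOpposite.op b) (a' ⊗ₜ MulOpposite.op b') g).trans <| by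
    rw [Algebra.TensorProduct.tmul_mul_tmul, ← MulOpposite.op_mul]
    rfl

theorem mk_mul_mk_one_one (a b : A) (h g : H) :
    mk (k := k) a b h * mk 1 1 g = mk a b (h * g) := by
  have e : mk (k := k) (1 : A) 1 h * mk 1 1 g = mk 1 1 (h * g) := by
    change lmulSmash k H A ((1 ⊗ₜ 1) ⊗ₜ h) ((1 ⊗ₜ 1) ⊗ₜ g) = _
    rw [lmulSmash_tmul, Module.End.mul_apply, act_one, leftEnv_tmul,
      ← Algebra.TensorProduct.one_def, one_mul]
    rfl
  have e' : mk (k := k) a b h = mk a b 1 * mk 1 1 h := by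
    rw [mk_one_mul_mk, mul_one, one_mul]
  rw [e', mul_assoc, e, mk_one_mul_mk, mul_one, one_mul]

variable (k H A) in
/-- Right multiplication by an element of `A`, as an element of the smash product. -/
noncomputable def right : A →ₗ[k] SmashEnv k H A where
  toFun b := mk 1 b 1
  map_add' a b := by
    change ((1 ⊗ₜ[k] MulOpposite.op (a + b)) ⊗ₜ[k] 1 : (A ⊗[k] Aᵐᵒᵖ) ⊗[k] H) = _
    rw [MulOpposite.op_add, TensorProduct.tmul_add, TensorProduct.add_tmul]
    rfl
  map_smul' c b := by
    change ((1 ⊗ₜ[k] MulOpposite.op (c • b)) ⊗ₜ[k] 1 : (A ⊗[k] Aᵐᵒᵖ) ⊗[k] H) = _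
    rw [MulOpposite.op_smul, TensorProduct.tmul_smul]
    rfl

variable (k H A) in
/-- The inclusion of `H` in the smash product. -/
noncomputable def hopf : H →ₐ[k] SmashEnv k H A :=
  AlgHom.ofLinearMap
    { toFun := fun h => mk 1 1 h
      map_add' := fun g h => TensorProduct.tmul_add ((1 : A) ⊗ₜ[k] (1 : Aᵐᵒᵖ)) g h
      map_smul' := fun c h => TensorProduct.tmul_smul c ((1 : A) ⊗ₜ[k] (1 : Aᵐᵒᵖ)) h }
    rfl (fun g h => (mk_mul_mk_one_one 1 1 g h).symm)

theorem right_def (b : A) : right k H A b = mk 1 b 1 := rfl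

theorem hopf_def (h : H) : hopf k H A h = mk 1 1 h := rfl

theorem right_mul (a b : A) : right k H A (a * b) = right k H A b * right k H A a := by
  rw [right_def, right_def, right_def, mk_one_mul_mk, mul_one]

theorem mk_one_one_mul_right (a b : A) :
    mk (k := k) a 1 (1 : H) * right k H A b = right k H A b * mk a 1 1 := by
  rw [right_def, mk_one_mul_mk, mk_one_mul_mk, mul_one, one_mul, one_mul, mul_one]

theorem mk_eq (a b : A) (h : H) :
    mk (k := k) a b h = mk a 1 1 * (right k H A b * hopf k H A h) := by
  rw [right_def, hopf_def, mk_one_mul_mk, mk_one_mul_mk, mul_one, one_mul, mul_one, mul_one]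

/-- The product formula gives Σ (h₁·1 ⊗ h₃·b) # h₂, and h₁·1 = ε(h₁) removes the first leg. In a
module over the smash product this is the rule h·(m b) = Σ (h₁·m)(h₂·b). -/
theorem hopf_mul_right (h : H) (b : A) :
    hopf k H A h * right k H A b = LinearMap.mul' k (SmashEnv k H A)
      (TensorProduct.map (right k H A ∘ₗ orbitMap k b) (hopf k H A).toLinearMap
        (TensorProduct.comm k H H (comul h))) := by
  let G : H ⊗[k] H →ₗ[k] SmashEnv k H A := LinearMap.mul' k (SmashEnv k H A) ∘ₗ
    TensorProduct.map (right k H A ∘ₗ orbitMap k b) (hopf k H A).toLinearMap ∘ₗ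
      (TensorProduct.comm k H H).toLinearMap
  have hG : ∀ q r : H, G (q ⊗ₜ r) = mk 1 (r • b) q := fun q r => by
    change right k H A (r • b) * hopf k H A q = _
    rw [right_def, hopf_def, mk_one_mul_mk, mul_one, one_mul]
  have key : ∀ X : H ⊗[k] (H ⊗[k] H),
      (act3 k H A X ((1 ⊗ₜ MulOpposite.op b) ⊗ₜ 1) : (A ⊗[k] Aᵐᵒᵖ) ⊗[k] H) =
      G (TensorProduct.lid k (H ⊗[k] H) (TensorProduct.map (counit (R := k)) LinearMap.id X)) := by
    intro X
    induction X using tripleInduction with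
    | h0 => simp; rfl
    | ha x y hx hy => simp only [map_add, LinearMap.add_apply, hx, hy]; rfl
    | ht p q r =>
      rw [act3_tmul, TensorProduct.map_tmul, TensorProduct.lid_tmul, map_smul, LinearMap.id_apply,
        hG, HModuleAlgebra.smul_one (k := k), Algebra.algebraMap_eq_smul_one, mul_one,
        ← TensorProduct.smul_tmul', ← TensorProduct.smul_tmul']
      rfl
  have e : TensorProduct.lid k (H ⊗[k] H) (TensorProduct.map (counit (R := k)) LinearMap.id
      (comul3 k H h)) = comul h := by
    have e1 : comul3 k H h = TensorProduct.map LinearMap.id comul (comul (R := k) h) := rfl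
    have e2 := rTensor_counit_comul (R := k) h
    have e3 : TensorProduct.map (counit (R := k) (A := H)) (comul (R := k) (A := H)) (comul h) =
        TensorProduct.map LinearMap.id comul (LinearMap.rTensor H (counit (R := k)) (comul h)) := by
      rw [LinearMap.rTensor, ← LinearMap.comp_apply (TensorProduct.map LinearMap.id comul),
        ← TensorProduct.map_comp, LinearMap.comp_id, LinearMap.id_comp]
    rw [e1, ← LinearMap.comp_apply (TensorProduct.map _ _), ← TensorProduct.map_comp,
      LinearMap.comp_id, LinearMap.id_comp]
    rw [e3, e2, TensorProduct.map_tmul, TensorProduct.lid_tmul]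
    simp
  have := key (comul3 k H h)
  rw [e] at this
  refine Eq.trans ?_ this
  change lmulSmash k H A ((1 ⊗ₜ 1) ⊗ₜ h) ((1 ⊗ₜ MulOpposite.op b) ⊗ₜ 1) = _
  rw [lmulSmash_tmul, ← Algebra.TensorProduct.one_def, map_one, one_mul]

theorem right_smul (b x : A) : right k H A b • x = x * b := by
  rw [right_def, mk_smul, one_mul, one_smul]

theorem hopf_smul (h : H) (x : A) : hopf k H A h • x = h • x := by
  rw [hopf_def, mk_smul, one_mul, mul_one]

theorem left_smul (a x : A) : mk (k := k) a 1 (1 : H) • x = a * x := by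
  rw [mk_smul, one_smul, mul_one]

end Generators

/-! ### Modules over the smash product and annihilators of H-stable ideals -/

section Modules
variable {k : Type u} {H : Type v} {A : Type w} [CommRing k] [Ring H] [HopfAlgebra k H] [Ring A]
  [Algebra k A] [Module H A] [IsScalarTower k H A] [HModuleAlgebra k H A]
  {M : Type*} [AddCommGroup M] [Module k M] [Module (SmashEnv k H A) M]
  [IsScalarTower k (SmashEnv k H A) M]

variable (k M) in
/-- The action of `H` on a module over the smash product. -/
noncomputable def hopfEnd : H →ₐ[k] Module.End k M :=
  (Algebra.lsmul k k M).comp (hopf k H A)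

/-- `h ↦ (x ↦ (h • m) x)` for `x` in an `H`-stable ideal. -/
noncomputable def translate (I : HIdeal H A) (m : M) : H →ₗ[k] (I.toSubmodule →ₗ[k] M) where
  toFun h :=
    { toFun := fun x => right k H A x.1 • (hopf k H A h • m)
      map_add' := fun x y => by rw [Submodule.coe_add, map_add, add_smul]
      map_smul' := fun c x => by
        rw [Submodule.coe_smul_of_tower, map_smul, smul_assoc, RingHom.id_apply] }
  map_add' g h := by ext x; simp [add_smul]
  map_smul' c h := by ext x; simp [smul_comm c]

theorem translate_apply (I : HIdeal H A) (m : M) (h : H) (x : I.toSubmodule) :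
    translate (k := k) I m h x = right k H A x.1 • (hopf k H A h • m) := rfl

/-- By `hopf_mul_right`, Σ (h₁·m)(h₂·x) = h·(m x), and the adjoint action is the only solution of
this equation (`adjAct_unique`). Explicitly, (h·m)x = Σ h₁·(m(S(h₂)·x)). -/
theorem translate_eq_adjAct (I : HIdeal H A) (m : M) :
    translate (k := k) I m =
      adjAct (I.act k) (hopfEnd (A := A) k M) (translate (k := k) I m 1) := by
  refine adjAct_unique _ _ _ _ fun h => ?_
  ext x
  change _ = hopf k H A h • (right k H A x.1 • (hopf k H A 1 • m))
  rw [map_one, one_smul, ← mul_smul, hopf_mul_right]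
  induction (comul (R := k) h) using TensorProduct.induction_on with
  | zero => simp
  | add s t hs ht => simp only [map_add, LinearMap.add_apply, hs, ht, add_smul]
  | tmul p q =>
    rw [pairRight_tmul]
    change right k H A (q • x.1) • (hopf k H A p • m) =
      (right k H A (q • x.1) * hopf k H A p) • m
    rw [mul_smul]

/-- Every inner factor m(S(h₂)·x) in the adjoint formula vanishes, since I is H-stable. The antipode
itself suffices here; for annihilators on the other side its inverse appears. -/
theorem right_smul_hopf_smul_eq_zero (I : HIdeal H A) (m : M)
    (hm : ∀ x ∈ I.toSubmodule, right k H A x • m = 0) (h : H) {x : A} (hx : x ∈ I.toSubmodule) :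
    right k H A x • (hopf k H A h • m) = 0 := by
  have e : translate (k := k) I m 1 = 0 := by
    ext y
    rw [translate_apply, map_one, one_smul, hm _ y.2, LinearMap.zero_apply]
  have := translate_eq_adjAct (k := k) I m
  rw [e, adjAct_zero] at this
  exact LinearMap.congr_fun (LinearMap.congr_fun this h) ⟨x, hx⟩

variable (k M) in
/-- The elements of `M` annihilated by right multiplication by an `H`-stable ideal. -/
def leftAnn (I : HIdeal H A) : Submodule (SmashEnv k H A) M where
  carrier := {m | ∀ x ∈ I.toSubmodule, right k H A x • m = 0}
  zero_mem' x _ := smul_zero _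
  add_mem' hm hn x hx := by rw [smul_add, hm x hx, hn x hx, add_zero]
  smul_mem' s m hm := by
    induction s using mk_induction with
    | h0 => intro x _; rw [zero_smul, smul_zero]
    | ha s t hs ht => intro x hx; rw [add_smul, smul_add, hs x hx, ht x hx, add_zero]
    | ht a b h =>
      intro x hx
      -- Left multiplication by a moves outside, and multiplying on the right by b and then by x is
      -- multiplying by b x, again an element of I.
      rw [mk_eq, mul_smul, mul_smul, ← mul_smul (right k H A x), ← mk_one_one_mul_right, mul_smul,
        ← mul_smul (right k H A x), ← right_mul,
        right_smul_hopf_smul_eq_zero I m hm h (I.mul_left b hx), smul_zero]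

variable (k) in
/-- An `H`-stable ideal as a submodule of `A` over the smash product. -/
def ofHIdeal (I : HIdeal H A) : Submodule (SmashEnv k H A) A where
  carrier := I.toSubmodule
  zero_mem' := I.toSubmodule.zero_mem
  add_mem' := I.toSubmodule.add_mem
  smul_mem' s x hx := by
    induction s using mk_induction with
    | h0 => rw [zero_smul]; exact I.toSubmodule.zero_mem
    | ha s t hs ht => rw [add_smul]; exact I.toSubmodule.add_mem hs ht
    | ht a b h => rw [mk_smul]; exact I.mul_right b (I.mul_left a (I.hsmul h hx))

/-- A submodule of `A` over the smash product as an `H`-stable ideal. -/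
def toHIdeal (N : Submodule (SmashEnv k H A) A) : HIdeal H A where
  carrier := N
  zero_mem' := N.zero_mem
  add_mem' := N.add_mem
  smul_mem' b x hx := by
    have := N.smul_mem (right k H A b.unop) hx
    rwa [right_smul] at this
  mul_mem_left' a x hx := by
    have := N.smul_mem (mk (k := k) a 1 (1 : H)) hx
    rwa [left_smul] at this
  hsmul_mem' h x hx := by
    have := N.smul_mem (hopf k H A h) hx
    rwa [hopf_smul] at this

theorem mem_toHIdeal {N : Submodule (SmashEnv k H A) A} {x : A} :
    x ∈ (toHIdeal N).toSubmodule ↔ x ∈ N := Iff.rfl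

/-- An additive map between modules over the smash product is linear if it commutes with left and
right multiplication and with the action of `H`. -/
theorem map_smul_of_map_mk {N : Type*} [AddCommGroup N] [Module (SmashEnv k H A) N]
    (f : N →+ M) (hl : ∀ (a : A) (x : N), f (mk (k := k) a 1 (1 : H) • x) =
      mk (k := k) a 1 (1 : H) • f x)
    (hr : ∀ (a : A) (x : N), f (right k H A a • x) = right k H A a • f x)
    (hh : ∀ (h : H) (x : N), f (hopf k H A h • x) = hopf k H A h • f x)
    (s : SmashEnv k H A) (x : N) : f (s • x) = s • f x := by
  induction s using mk_induction with
  | h0 => rw [zero_smul, zero_smul, map_zero]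
  | ha s t hs ht => rw [add_smul, add_smul, map_add, hs, ht]
  | ht a b h => rw [mk_eq, mul_smul, mul_smul, hl, hr, hh, mul_smul, mul_smul]

end Modules
end SmashEnv

/-! ### Essential submodules -/

namespace Submodule

variable {R M N : Type*} [Ring R] [AddCommGroup M] [Module R M] [AddCommGroup N] [Module R N]

/-- A submodule is essential if it meets every nonzero submodule nontrivially. -/
def IsEssential (U : Submodule R M) : Prop := ∀ L : Submodule R M, L ⊓ U = ⊥ → L = ⊥

theorem isEssential_top : (⊤ : Submodule R M).IsEssential := fun L hL => by
  rwa [inf_top_eq] at hL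

theorem IsEssential.inf {U V : Submodule R M} (hU : U.IsEssential) (hV : V.IsEssential) :
    (U ⊓ V).IsEssential := fun L hL => hU L (hV _ (by rw [inf_assoc, hL]))

/-- If L misses f⁻¹(U), then f(L) misses U, so f kills L. But then L lies in f⁻¹(U). -/
theorem IsEssential.comap {U : Submodule R N} (hU : U.IsEssential) (f : M →ₗ[R] N) :
    (U.comap f).IsEssential := by
  intro L hL
  have h1 : L.map f = ⊥ := by
    refine hU _ (eq_bot_iff.2 ?_)
    rintro _ ⟨⟨x, hx, rfl⟩, hx'⟩
    have : x ∈ L ⊓ U.comap f := ⟨hx, hx'⟩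
    rw [hL, mem_bot] at this
    rw [this, map_zero]
    exact zero_mem _
  rw [eq_bot_iff, ← hL]
  refine le_inf le_rfl fun x hx => ?_
  have h2 : f x ∈ L.map f := mem_map_of_mem hx
  rw [h1, mem_bot] at h2
  rw [mem_comap, h2]
  exact U.zero_mem

theorem IsEssential.iInf {ι : Type*} [Finite ι] {U : ι → Submodule R M}
    (hU : ∀ j, (U j).IsEssential) : (⨅ j, U j).IsEssential := by
  classical
  cases nonempty_fintype ι
  have : ∀ s : Finset ι, (⨅ j ∈ s, U j).IsEssential := by
    intro s
    induction s using Finset.induction_on with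
    | empty => simpa using isEssential_top
    | insert a s _ ih => rw [Finset.iInf_insert]; exact (hU a).inf ih
  simpa using this Finset.univ

end Submodule
-- Essential ideals and faithful ideals
namespace HIdeal

variable {k : Type u} {H : Type v} {A : Type w} [CommRing k] [Ring H] [HopfAlgebra k H] [Ring A]
  [Algebra k A] [Module H A] [IsScalarTower k H A] [HModuleAlgebra k H A]

/-- If the antipode is bijective, the right annihilator of an `H`-stable ideal is `H`-stable. -/
theorem mul_hsmul_eq_zero (hS : Function.Bijective (HopfAlgebra.antipode k : H →ₗ[k] H))
    (I : HIdeal H A) {a : A} (ha : ∀ x ∈ I.toSubmodule, x * a = 0) (h : H) {x : A}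
    (hx : x ∈ I.toSubmodule) : x * h • a = 0 := by
  -- `T` is the inverse of the antipode, and `w` expresses the identity Σ h₂ S⁻¹(h₁) = ε(h).
  -- Applying S reduces it to Σ h₁ S(h₂) = ε(h).
  let T : H →ₗ[k] H := (LinearEquiv.ofBijective (HopfAlgebra.antipode k) hS).symm.toLinearMap
  have hT : ∀ g, HopfAlgebra.antipode k (T g) = g :=
    (LinearEquiv.ofBijective (HopfAlgebra.antipode k) hS).apply_symm_apply
  let w : H ⊗[k] H →ₗ[k] H := LinearMap.mul' k H ∘ₗ (TensorProduct.comm k H H).toLinearMap ∘ₗ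
    TensorProduct.map T LinearMap.id
  have hw : ∀ p q, w (p ⊗ₜ q) = q * T p := fun _ _ => rfl
  have hw_comul : ∀ g, w (comul g) = algebraMap k H (counit g) := by
    intro g
    apply hS.1
    have e : ∀ X, HopfAlgebra.antipode k (w X) =
        LinearMap.mul' k H (LinearMap.lTensor H (HopfAlgebra.antipode k) X) := by
      intro X
      induction X using TensorProduct.induction_on with
      | zero => simp
      | add s t hs ht => simp only [map_add, hs, ht]
      | tmul p q => rw [hw, HopfAlgebra.antipode_mul_antidistrib, hT]; rfl
    rw [e, HopfAlgebra.mul_antipode_lTensor_comul_apply, Algebra.algebraMap_eq_smul_one, map_smul,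
      HopfAlgebra.antipode_one]
  -- On the iterated coproduct `Ω` has the value Σ (h₂S⁻¹(h₁)·x)(h₃·a). Grouping h₂ with h₃ gives Σ
  -- h₂·((S⁻¹(h₁)·x)a) = 0; grouping h₁ with h₂ gives x(h·a).
  let Ω : H ⊗[k] (H ⊗[k] H) →ₗ[k] A := LinearMap.mul' k A ∘ₗ
    TensorProduct.map (orbitMap k x ∘ₗ w) (orbitMap k a) ∘ₗ
      (TensorProduct.assoc k H H H).symm.toLinearMap
  have hΩ : ∀ p q r, Ω (p ⊗ₜ (q ⊗ₜ r)) = (q • T p • x) * (r • a) := fun p q r => by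
    rw [← mul_smul]; rfl
  have hzero : ∀ X : H ⊗[k] H, Ω (TensorProduct.map LinearMap.id comul X) = 0 := by
    intro X
    induction X using TensorProduct.induction_on with
    | zero => simp
    | add s t hs ht => rw [map_add, map_add, hs, ht, add_zero]
    | tmul p q =>
      have e : ∀ Y : H ⊗[k] H, Ω (p ⊗ₜ Y) = LinearMap.mul' k A
          (TensorProduct.map (orbitMap k (T p • x)) (orbitMap k a) Y) := by
        intro Y
        induction Y using TensorProduct.induction_on with
        | zero => simp
        | add s t hs ht => rw [TensorProduct.tmul_add, map_add, map_add, map_add, hs, ht]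
        | tmul q r => rw [hΩ]; rfl
      rw [TensorProduct.map_tmul, LinearMap.id_apply, e, ← HModuleAlgebra.smul_mul (k := k),
        ha _ (I.hsmul _ hx), smul_zero]
  have e1 := coassoc_symm_apply (R := k) h
  rw [LinearMap.rTensor, LinearMap.lTensor] at e1
  have e2 : ∀ X : H ⊗[k] H, LinearMap.mul' k A (TensorProduct.map (orbitMap k x ∘ₗ w)
      (orbitMap k a) (TensorProduct.map comul LinearMap.id X)) =
      x * (TensorProduct.lid k H (LinearMap.rTensor H (counit (R := k)) X)) • a := by
    intro X
    induction X using TensorProduct.induction_on with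
    | zero => simp
    | add s t hs ht => simp only [map_add, hs, ht, add_smul, mul_add]
    | tmul p q =>
      rw [TensorProduct.map_tmul, TensorProduct.map_tmul, LinearMap.comp_apply, hw_comul]
      change (algebraMap k H (counit p) • x) * (q • a) = x * ((counit (R := k) p • q) • a)
      rw [algebraMap_smul, smul_assoc, smul_mul_assoc (counit (R := k) p) x,
        ← mul_smul_comm (counit (R := k) p) x]
  have e3 := hzero (comul h)
  change LinearMap.mul' k A (TensorProduct.map (orbitMap k x ∘ₗ w) (orbitMap k a)
    ((TensorProduct.assoc k H H H).symm (TensorProduct.map LinearMap.id comul (comul h)))) = 0 at e3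
  rw [e1, e2, rTensor_counit_comul, TensorProduct.lid_tmul, one_smul] at e3
  exact e3

/-- The right annihilator of an `H`-stable ideal, when it is `H`-stable. -/
def rightAnn (I : HIdeal H A)
    (hI : ∀ a : A, (∀ x ∈ I.toSubmodule, x * a = 0) → ∀ (h : H), ∀ x ∈ I.toSubmodule,
      x * h • a = 0) : HIdeal H A where
  carrier := {a | ∀ x ∈ I.toSubmodule, x * a = 0}
  zero_mem' x _ := mul_zero x
  add_mem' ha hb x hx := by rw [mul_add, ha x hx, hb x hx, add_zero]
  smul_mem' b a ha x hx := by rw [mul_smul_comm, ha x hx, smul_zero]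
  mul_mem_left' b a ha x hx := by rw [← mul_assoc]; exact ha _ (I.mul_right b hx)
  hsmul_mem' h a ha x hx := hI a ha h x hx

/-- In each of the three cases, an `H`-stable ideal with zero left annihilator is faithful. -/
theorem faithful_of_left (hA : IsHSemiprime H A)
    (hcase : (∀ a b : A, a * b = b * a) ∨ IsSemiprimeAlgebra A ∨
      Function.Bijective (HopfAlgebra.antipode k : H →ₗ[k] H))
    (I : HIdeal H A) (hI : ∀ a : A, (∀ x ∈ I.toSubmodule, a * x = 0) → a = 0) : I.Faithful := by
  -- Since the left annihilator of I is zero, it is enough to show a x = 0 for all x in I.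
  refine ⟨hI, fun a ha => hI a fun x hx => ?_⟩
  rcases hcase with h | h | h
  · rw [h, ha x hx]
  -- The product a x lies in I and in its right annihilator, whose intersection is a two-sided ideal
  -- of square zero.
  · let K : TwoSidedIdeal A := TwoSidedIdeal.mk'
      {y | y ∈ I.toSubmodule ∧ ∀ x ∈ I.toSubmodule, x * y = 0}
      ⟨I.toSubmodule.zero_mem, fun x _ => mul_zero x⟩
      (fun hy hz => ⟨I.toSubmodule.add_mem hy.1 hz.1, fun x hx => by
        rw [mul_add, hy.2 x hx, hz.2 x hx, add_zero]⟩)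
      (fun hy => ⟨I.toSubmodule.neg_mem hy.1, fun x hx => by rw [mul_neg, hy.2 x hx, neg_zero]⟩)
      (fun {b y} hy => ⟨I.mul_left b hy.1, fun x hx => by
        rw [← mul_assoc]; exact hy.2 _ (I.mul_right b hx)⟩)
      (fun {y b} hy => ⟨I.mul_right b hy.1, fun x hx => by rw [← mul_assoc, hy.2 x hx, zero_mul]⟩)
    have hK : ∀ y, y ∈ K ↔ y ∈ I.toSubmodule ∧ ∀ x ∈ I.toSubmodule, x * y = 0 :=
      fun y => TwoSidedIdeal.mem_mk' _ _ _ _ _ _ _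
    have hbot := h K fun y hy z hz => ((hK z).1 hz).2 y ((hK y).1 hy).1
    have : a * x ∈ K := (hK _).2 ⟨I.mul_left a hx, fun y hy => by
      rw [← mul_assoc, ha y hy, zero_mul]⟩
    rwa [hbot, TwoSidedIdeal.mem_bot] at this
  -- The same intersection is now H-stable, so H-semiprimeness takes the place of semiprimeness.
  · have hbot := hA (I.inf (I.rightAnn fun b hb g y hy => mul_hsmul_eq_zero h I hb g hy))
      fun y hy z hz => hz.2 y hy.1
    have : a * x ∈ (I.inf (I.rightAnn fun b hb g y hy =>
        mul_hsmul_eq_zero h I hb g hy)).toSubmodule :=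
      ⟨I.mul_left a hx, fun y hy => by rw [← mul_assoc, ha y hy, zero_mul]⟩
    rwa [hbot, Submodule.mem_bot] at this

open SmashEnv in
-- In a product of two elements of the intersection the first annihilates I and the second lies in
-- I. So the intersection is an H-stable ideal of square zero.
theorem ofHIdeal_inf_leftAnn (hA : IsHSemiprime H A) (I : HIdeal H A) :
    ofHIdeal k I ⊓ leftAnn k A I = ⊥ := by
  have h := hA (toHIdeal (ofHIdeal k I ⊓ leftAnn k A I)) fun x hx y hy => by
    have := hx.2 y hy.1
    rwa [right_smul] at this
  rw [eq_bot_iff]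
  intro x hx
  have hx' : x ∈ (toHIdeal (ofHIdeal k I ⊓ leftAnn k A I)).toSubmodule := hx
  rwa [h, Submodule.mem_bot] at hx'

open SmashEnv in
theorem faithful_of_isEssential (hA : IsHSemiprime H A)
    (hcase : (∀ a b : A, a * b = b * a) ∨ IsSemiprimeAlgebra A ∨
      Function.Bijective (HopfAlgebra.antipode k : H →ₗ[k] H))
    {U : Submodule (SmashEnv k H A) A} (hU : U.IsEssential) : (toHIdeal U).Faithful := by
  refine faithful_of_left (k := k) hA hcase _ fun a ha => ?_
  have h : a ∈ leftAnn k A (toHIdeal U) := fun x hx => by rw [right_smul, ha x hx]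
  have hb : leftAnn k A (toHIdeal U) = ⊥ := hU _ (by
    rw [inf_comm]
    exact ofHIdeal_inf_leftAnn (k := k) hA (toHIdeal U))
  rwa [hb, Submodule.mem_bot] at h

open SmashEnv in
/-- The sum of an `H`-stable ideal and its left annihilator is essential. -/
theorem isEssential_sup_leftAnn (I : HIdeal H A) :
    (ofHIdeal k I ⊔ leftAnn k A I).IsEssential := by
  intro L hL
  -- If L misses the sum, then L I, being contained in both L and I, is zero. So L lies in the
  -- annihilator, a summand of what it misses.
  have h : L ≤ leftAnn k A I := by
    intro y hy x hx
    rw [right_smul]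
    have h1 : y * x ∈ L ⊓ (ofHIdeal k I ⊔ leftAnn k A I) := by
      refine ⟨?_, Submodule.mem_sup_left (I.mul_left y hx)⟩
      rw [← right_smul (k := k) (H := H)]
      exact L.smul_mem _ hy
    rwa [hL, Submodule.mem_bot] at h1
  rw [eq_bot_iff, ← hL]
  exact le_inf le_rfl (h.trans le_sup_right)

open SmashEnv in
/-- Right multiplication by a faithful ideal is faithful on an essential extension of `A`. -/
theorem eq_zero_of_right_smul {E : Type*} [AddCommGroup E] [Module k E]
    [Module (SmashEnv k H A) E] [IsScalarTower k (SmashEnv k H A) E] (i : A →ₗ[SmashEnv k H A] E)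
    (hi : Function.Injective i) (hess : (LinearMap.range i).IsEssential) {I : HIdeal H A}
    (hI : I.Faithful) {γ : E} (h : ∀ x ∈ I.toSubmodule, right k H A x • γ = 0) : γ = 0 := by
  -- The annihilator of I in E is a submodule, and it meets A in the left annihilator of I, which is
  -- zero; A is essential in E.
  have hb : leftAnn k E I = ⊥ := by
    refine hess _ (eq_bot_iff.2 ?_)
    rintro _ ⟨hy, a, rfl⟩
    have : a = 0 := hI.1 a fun x hx => hi (by
      have := hy x hx
      rwa [← map_smul, right_smul, ← map_zero i] at this)
    rw [this, map_zero]
    exact zero_mem _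
  have : γ ∈ leftAnn k E I := h
  rwa [hb, Submodule.mem_bot] at this

/-- The locus where f and g agree is a right submodule, and the products x y generate the ideal as a
right module. -/
theorem mul_hom_ext {I J : HIdeal H A} {M : Type*} [AddCommGroup M] [Module Aᵐᵒᵖ M]
    (f g : (mul k I J).toSubmodule →ₗ[Aᵐᵒᵖ] M)
    (h : ∀ x (hx : x ∈ I.toSubmodule) y (hy : y ∈ J.toSubmodule),
      f ⟨x * y, mul_mem_mul k I J hx hy⟩ = g ⟨x * y, mul_mem_mul k I J hx hy⟩) : f = g := by
  have hle : (mul k I J).toSubmodule ≤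
      (LinearMap.eqLocus f g).map (mul k I J).toSubmodule.subtype :=
    mul_le k I J _ fun x hx y hy => ⟨⟨x * y, mul_mem_mul k I J hx hy⟩, h x hx y hy, rfl⟩
  ext x
  obtain ⟨y, hy, hyx⟩ := hle x.2
  rwa [← Subtype.ext hyx]

end HIdeal

/-! ### Partial maps whose classes are central or invariant -/

namespace MartindaleQuotient

variable {k : Type u} {H : Type v} {A : Type w} [CommRing k] [Ring H] [HopfAlgebra k H] [Ring A]
  [Algebra k A] [Module H A] [IsScalarTower k H A] [HModuleAlgebra k H A]

/-- Equivalent partial maps agree wherever both are defined. -/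
theorem map_eq_of_mk_eq {f g : PartialHom H A} (h : mk k f = mk k g) {x : A}
    (hf : x ∈ f.dom.toSubmodule) (hg : x ∈ g.dom.toSubmodule) :
    f.map ⟨x, hf⟩ = g.map ⟨x, hg⟩ := by
  obtain ⟨K, hK, hKf, hKg, e⟩ := Quotient.exact (s := PartialHom.setoid k H A) h
  rw [← sub_eq_zero]
  -- For y in K also x y lies in K, where f and g agree, so right linearity gives (f(x) − g(x))y =
  -- 0.
  refine hK.1 _ fun y hy => ?_
  rw [sub_mul, ← PartialHom.map_mul_right f ⟨x, hf⟩ y, ← PartialHom.map_mul_right g ⟨x, hg⟩ y,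
    sub_eq_zero]
  exact e _ (K.mul_left x hy)

/-- A partial map whose class commutes with `A` is left `A`-linear. -/
theorem map_mul_left_of_commute {f : PartialHom H A}
    (h : ∀ a : A, mk k f * incl k H A a = incl k H A a * mk k f) (a : A) {x : A}
    (hx : x ∈ f.dom.toSubmodule) :
    f.map ⟨a * x, f.dom.mul_left a hx⟩ = a * f.map ⟨x, hx⟩ := by
  rw [← sub_eq_zero]
  -- The hypothesis compares two composites, which are defined on product ideals. The extra factor y
  -- brings x into both of them, and faithfulness of the domain removes it again.
  refine f.faithful.1 _ fun y hy => ?_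
  rw [sub_mul, mul_assoc a, ← PartialHom.map_mul_right f ⟨x, hx⟩ y,
    ← PartialHom.map_mul_right f ⟨a * x, f.dom.mul_left a hx⟩ y, sub_eq_zero]
  have hl : x * y ∈ (f.mul k (PartialHom.left H a)).dom.toSubmodule :=
    HIdeal.mul_mem_mul k HIdeal.top f.dom trivial hy
  have hr : x * y ∈ ((PartialHom.left H a).mul k f).dom.toSubmodule :=
    HIdeal.mul_mem_mul k f.dom HIdeal.top hx trivial
  have e := map_eq_of_mk_eq (k := k) (f := f.mul k (PartialHom.left H a))
    (g := (PartialHom.left H a).mul k f) (h a) hl hr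
  refine Eq.trans ?_ e
  exact congrArg f.map (Subtype.ext (mul_assoc a x y))

/-- A partial map whose class is `H`-invariant is `H`-linear. -/
theorem map_hsmul_of_invariant {f : PartialHom H A}
    (h : ∀ g : H, g • mk k f = counit (R := k) g • mk k f) (g : H) {x : A}
    (hx : x ∈ f.dom.toSubmodule) :
    f.map ⟨g • x, f.dom.hsmul g hx⟩ = g • f.map ⟨x, hx⟩ := by
  have e : ∀ (p : H) (y : f.dom.toSubmodule),
      PartialHom.actLin k f p y = counit (R := k) p • f.map y := fun p y => by
    have := h p
    rw [hsmul_mk, smul_mk] at this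
    exact map_eq_of_mk_eq this y.2 y.2
  -- Here g·f(x) = Σ (g₁·f)(g₂·x), and invariance turns the right side into Σ ε(g₁) f(g₂·x) =
  -- f(g·x).
  have e1 := LinearMap.congr_fun (PartialHom.sum_actLin k f g) ⟨x, hx⟩
  have e2 : ∀ X : H ⊗[k] H, pairRight (f.dom.act k) (PartialHom.actLin k f) X ⟨x, hx⟩ =
      f.lin k (f.dom.act k (TensorProduct.lid k H (LinearMap.rTensor H (counit (R := k)) X))
        ⟨x, hx⟩) := by
    intro X
    induction X using TensorProduct.induction_on with
    | zero => simp
    | add s t hs ht => simp only [map_add, LinearMap.add_apply, hs, ht]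
    | tmul p q =>
      rw [pairRight_tmul, LinearMap.comp_apply, e, LinearMap.rTensor_tmul,
        TensorProduct.lid_tmul, map_smul, LinearMap.smul_apply, map_smul]
      rfl
  rw [e2, rTensor_counit_comul, TensorProduct.lid_tmul, one_smul] at e1
  exact e1

end MartindaleQuotient
-- Elements of an extension of A as partial maps
namespace PartialHom

open SmashEnv MartindaleQuotient

variable {k : Type u} {H : Type v} {A : Type w} [CommRing k] [Ring H] [HopfAlgebra k H] [Ring A]
  [Algebra k A] [Module H A] [IsScalarTower k H A] [HModuleAlgebra k H A]
  {M : Type*} [AddCommGroup M] [Module k M] [Module (SmashEnv k H A) M]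
  [IsScalarTower k (SmashEnv k H A) M] {j : A →ₗ[SmashEnv k H A] M}

/-- The partial map `p` is left multiplication by the element `γ` of the extension `j : A → M`. -/
def Represents (j : A →ₗ[SmashEnv k H A] M) (γ : M) (p : PartialHom H A) : Prop :=
  ∀ y : p.dom.toSubmodule, j (p.map y) = right k H A y.1 • γ

/-- Left multiplication by `γ`, as a partial map on an ideal that it maps into `A`. -/
noncomputable def ofElement (hj : Function.Injective j) (γ : M)
    (N : Submodule (SmashEnv k H A) A) (hN : (toHIdeal N).Faithful)
    (h : ∀ y ∈ N, ∃ b, j b = right k H A y • γ) : PartialHom H A where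
  dom := toHIdeal N
  faithful := hN
  map :=
    { toFun := fun y => (h y.1 y.2).choose
      map_add' := fun x y => hj (by
        rw [map_add, (h _ (x + y).2).choose_spec, (h _ x.2).choose_spec, (h _ y.2).choose_spec,
          Submodule.coe_add, map_add, add_smul])
      map_smul' := fun b x => hj (by
        rw [(h _ (b • x).2).choose_spec]
        change right k H A (x.1 * b.unop) • γ = j ((h _ x.2).choose * b.unop)
        rw [right_mul, mul_smul, ← right_smul (k := k) (H := H) b.unop, map_smul,
          (h _ x.2).choose_spec]) }

theorem ofElement_represents (hj : Function.Injective j) {γ : M}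
    {N : Submodule (SmashEnv k H A) A} (hN : (toHIdeal N).Faithful)
    (h : ∀ y ∈ N, ∃ b, j b = right k H A y • γ) :
    Represents j γ (ofElement hj γ N hN h) :=
  fun y => (h y.1 y.2).choose_spec

namespace Represents

/-- Injectivity of j makes γ determine the values of the map, whatever the chosen domain. Thus the
class [L_γ] is well defined. -/
theorem mk_eq (hj : Function.Injective j) {γ : M} {p q : PartialHom H A}
    (hp : Represents j γ p) (hq : Represents j γ q) :
    MartindaleQuotient.mk k p = MartindaleQuotient.mk k q :=
  sound (p.dom.inf q.dom) (HIdeal.inf_faithful k p.faithful q.faithful) inf_le_left inf_le_right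
    fun x hx => hj ((hp ⟨x, hx.1⟩).trans (hq ⟨x, hx.2⟩).symm)

theorem add {γ δ : M} {p q : PartialHom H A} (hp : Represents j γ p) (hq : Represents j δ q) :
    Represents j (γ + δ) (p.add k q) := fun y => by
  rw [smul_add, ← hp ⟨y.1, y.2.1⟩, ← hq ⟨y.1, y.2.2⟩, ← map_add]
  rfl

theorem smul {γ : M} {p : PartialHom H A} (hp : Represents j γ p) (c : k) :
    Represents j (c • γ) ⟨p.dom, p.faithful, c • p.map⟩ := fun y => by
  rw [smul_comm, ← hp y, ← algebraMap_smul (SmashEnv k H A) c (j (p.map y)), ← map_smul,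
    algebraMap_smul]
  rfl

theorem left (j : A →ₗ[SmashEnv k H A] M) (a : A) :
    Represents j (j a) (PartialHom.left H a) := fun y => by
  rw [← map_smul, right_smul]
  rfl

theorem right_smul {γ : M} {p : PartialHom H A} (hp : Represents j γ p) (a : A) :
    Represents j (right k H A a • γ) (p.mul k (PartialHom.left H a)) := fun y => by
  rw [← mul_smul, ← right_mul]
  exact hp ⟨a * y.1, map_mem k (PartialHom.left H a) p.dom y.2⟩

theorem left_smul {γ : M} {p : PartialHom H A} (hp : Represents j γ p) (a : A) :
    Represents j (SmashEnv.mk (k := k) a 1 (1 : H) • γ) ((PartialHom.left H a).mul k p) :=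
  fun y => by
    rw [← mul_smul, ← mk_one_one_mul_right, mul_smul, ← hp ⟨y.1, HIdeal.mul_le_left k _ _ y.2⟩,
      ← map_smul, SmashEnv.left_smul]
    rfl

/-- The formula (h·γ)y = Σ h₁·(γ(S(h₂)·y)), valid in M by `translate_eq_adjAct`, is the one that
defines the action of H on partial maps. -/
theorem hsmul {γ : M} {p : PartialHom H A} (hp : Represents j γ p) (h : H) :
    Represents j (hopf k H A h • γ) (p.hact k h) := by
  intro (y : p.dom.toSubmodule)
  have e := LinearMap.congr_fun (LinearMap.congr_fun
    (translate_eq_adjAct (k := k) p.dom γ) h) y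
  refine Eq.trans ?_ e.symm
  change j (adjPair (p.dom.act k) (Algebra.lsmul k k A) (p.lin k) (comul h) y) =
    adjPair (p.dom.act k) (hopfEnd (A := A) k M) (translate (k := k) p.dom γ 1) (comul h) y
  induction (comul (R := k) h) using TensorProduct.induction_on with
  | zero => simp
  | add s t hs ht => simp only [map_add, LinearMap.add_apply, hs, ht]
  | tmul q r =>
    rw [adjPair_tmul, adjPair_tmul]
    change j (q • p.map (p.dom.act k (HopfAlgebra.antipode k r) y)) = hopf k H A q •
      (right k H A (p.dom.act k (HopfAlgebra.antipode k r) y).1 • (hopf k H A 1 • γ))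
    rw [map_one, one_smul, ← hp, ← map_smul j, hopf_smul]

/-- An endomorphism commutes with right multiplication, so s(1)y = s(y). Left multiplication by s(1)
is therefore the restriction of s, and composites of endomorphisms give composites of partial maps.
-/
theorem end_apply {s : Module.End (SmashEnv k H A) M} {p : PartialHom H A}
    (hp : Represents j (s (j 1)) p) (y : p.dom.toSubmodule) : j (p.map y) = s (j y) := by
  rw [hp y, ← map_smul, ← map_smul, SmashEnv.right_smul, one_mul]

theorem comp {s t : Module.End (SmashEnv k H A) M} {p q : PartialHom H A}
    (hp : Represents j (s (j 1)) p) (hq : Represents j (t (j 1)) q) :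
    Represents j ((s * t) (j 1)) (p.mul k q) := fun y => by
  rw [← map_smul, ← map_smul, SmashEnv.right_smul, one_mul, Module.End.mul_apply,
    ← hq.end_apply ⟨y.1, HIdeal.mul_le_left k _ _ y.2⟩]
  exact hp.end_apply ⟨q.map ⟨y.1, HIdeal.mul_le_left k _ _ y.2⟩, map_mem k q p.dom y.2⟩

theorem map_mul_left (hj : Function.Injective j) {s : Module.End (SmashEnv k H A) M}
    {p : PartialHom H A} (hp : Represents j (s (j 1)) p) (a : A) (y : p.dom.toSubmodule) :
    p.map ⟨a * y.1, p.dom.mul_left a y.2⟩ = a * p.map y := by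
  apply hj
  refine (hp.end_apply _).trans ?_
  change s (j (a * y.1)) = _
  rw [← SmashEnv.left_smul (k := k) (H := H), ← SmashEnv.left_smul (k := k) (H := H), map_smul, map_smul, map_smul, hp.end_apply]

/-- The map p is linear on both sides and f on the right. For x, y in both domains, p(f(x)y) =
f(x)p(y) = f(x p(y)) = f(p(x y)), so the two composites agree on the square of the intersection of
the domains. -/
theorem commute (hj : Function.Injective j) {s : Module.End (SmashEnv k H A) M}
    {p : PartialHom H A} (hp : Represents j (s (j 1)) p) (q : MartindaleQuotient k H A) :
    MartindaleQuotient.mk k p * q = q * MartindaleQuotient.mk k p := by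
  obtain ⟨f, rfl⟩ := mk_surjective q
  have hI : (f.dom.inf p.dom).Faithful := HIdeal.inf_faithful k f.faithful p.faithful
  have h1 : (HIdeal.mul k (f.dom.inf p.dom) (f.dom.inf p.dom)).toSubmodule ≤
      (p.mul k f).dom.toSubmodule :=
    HIdeal.mul_le k _ _ _ fun x hx y hy => HIdeal.mul_mem_mul k _ _ hx.1 hy.2
  have h2 : (HIdeal.mul k (f.dom.inf p.dom) (f.dom.inf p.dom)).toSubmodule ≤
      (f.mul k p).dom.toSubmodule :=
    HIdeal.mul_le k _ _ _ fun x hx y hy => HIdeal.mul_mem_mul k _ _ hx.2 hy.1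
  have e : (p.mul k f).map ∘ₗ Submodule.inclusion h1 =
      (f.mul k p).map ∘ₗ Submodule.inclusion h2 := by
    refine HIdeal.mul_hom_ext _ _ fun x hx y hy => ?_
    have e1 : (p.mul k f).map ⟨x * y, h1 (HIdeal.mul_mem_mul k _ _ hx hy)⟩ =
        p.map ⟨f.map ⟨x, hx.1⟩ * y, p.dom.mul_left _ hy.2⟩ :=
      congrArg p.map (Subtype.ext (map_mul_right f ⟨x, hx.1⟩ y))
    have e2 : (f.mul k p).map ⟨x * y, h2 (HIdeal.mul_mem_mul k _ _ hx hy)⟩ =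
        f.map ⟨x * p.map ⟨y, hy.2⟩, f.dom.mul_right _ hx.1⟩ :=
      congrArg f.map (Subtype.ext (hp.map_mul_left hj x ⟨y, hy.2⟩))
    refine e1.trans (Eq.trans ?_ e2.symm)
    rw [map_mul_right f ⟨x, hx.1⟩, hp.map_mul_left hj _ ⟨y, hy.2⟩]
  exact sound _ (HIdeal.mul_faithful k hI hI) h1 h2 fun x hx => LinearMap.congr_fun e ⟨x, hx⟩

/-- As s is H-linear, h·s(1) = s(h·1) = ε(h)s(1), and the class depends only on the element
represented. -/
theorem invariant (hj : Function.Injective j) {s : Module.End (SmashEnv k H A) M}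
    {p : PartialHom H A} (hp : Represents j (s (j 1)) p) (h : H) :
    h • MartindaleQuotient.mk k p = counit (R := k) h • MartindaleQuotient.mk k p := by
  rw [hsmul_mk, smul_mk]
  refine mk_eq hj (hp.hsmul h) ?_
  have e := hp.smul (counit (R := k) h)
  have e' : hopf k H A h • s (j 1) = counit (R := k) h • s (j 1) := by
    rw [← map_smul, ← map_smul, hopf_smul, HModuleAlgebra.smul_one (k := k),
      ← algebraMap_smul (SmashEnv k H A) (counit (R := k) h) (s (j 1)), ← map_smul, ← map_smul,
      algebraMap_smul, Algebra.algebraMap_eq_smul_one]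
  rwa [e']

theorem mem_centralInvariants (hj : Function.Injective j) {s : Module.End (SmashEnv k H A) M}
    {p : PartialHom H A} (hp : Represents j (s (j 1)) p) :
    MartindaleQuotient.mk k p ∈ centralInvariants k H (MartindaleQuotient k H A) :=
  ⟨hp.commute hj, hp.invariant hj⟩

end Represents

/-- The map `γ ↦ [L_γ]` from an extension of `A` to the Martindale quotient ring. -/
noncomputable def repMap (hj : Function.Injective j) (hrep : ∀ γ, ∃ p, Represents j γ p) :
    M →ₗ[k] MartindaleQuotient k H A where
  toFun γ := MartindaleQuotient.mk k (hrep γ).choose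
  map_add' γ δ := Represents.mk_eq hj (hrep (γ + δ)).choose_spec
    ((hrep γ).choose_spec.add (hrep δ).choose_spec)
  map_smul' c γ := by
    rw [RingHom.id_apply, smul_mk]
    exact Represents.mk_eq hj (hrep (c • γ)).choose_spec ((hrep γ).choose_spec.smul c)

variable (hj : Function.Injective j) (hrep : ∀ γ, ∃ p, Represents j γ p)

theorem repMap_eq {γ : M} {p : PartialHom H A} (hp : Represents j γ p) :
    repMap hj hrep γ = MartindaleQuotient.mk k p :=
  Represents.mk_eq hj (hrep γ).choose_spec hp

theorem repMap_self (a : A) : repMap hj hrep (j a) = inclAlg (k := k) (H := H) a :=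
  repMap_eq hj hrep (Represents.left j a)

theorem repMap_right_smul (γ : M) (a : A) : repMap hj hrep (right k H A a • γ) =
    repMap hj hrep γ * inclAlg (k := k) (H := H) a := by
  obtain ⟨p, hp⟩ := hrep γ
  rw [repMap_eq hj hrep hp, repMap_eq hj hrep (hp.right_smul a)]
  rfl

theorem repMap_left_smul (γ : M) (a : A) :
    repMap hj hrep (SmashEnv.mk (k := k) a 1 (1 : H) • γ) =
      inclAlg (k := k) (H := H) a * repMap hj hrep γ := by
  obtain ⟨p, hp⟩ := hrep γ
  rw [repMap_eq hj hrep hp, repMap_eq hj hrep (hp.left_smul a)]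
  rfl

theorem repMap_hopf_smul (γ : M) (h : H) :
    repMap hj hrep (hopf k H A h • γ) = h • repMap hj hrep γ := by
  obtain ⟨p, hp⟩ := hrep γ
  rw [repMap_eq hj hrep hp, repMap_eq hj hrep (hp.hsmul h)]
  rfl

theorem repMap_end_mul (s t : Module.End (SmashEnv k H A) M) :
    repMap hj hrep ((s * t) (j 1)) = repMap hj hrep (s (j 1)) * repMap hj hrep (t (j 1)) := by
  obtain ⟨p, hp⟩ := hrep (s (j 1))
  obtain ⟨q, hq⟩ := hrep (t (j 1))
  rw [repMap_eq hj hrep hp, repMap_eq hj hrep hq, repMap_eq hj hrep (hp.comp hq)]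
  rfl

theorem repMap_end_mem (s : Module.End (SmashEnv k H A) M) :
    repMap hj hrep (s (j 1)) ∈ centralInvariants k H (MartindaleQuotient k H A) := by
  obtain ⟨p, hp⟩ := hrep (s (j 1))
  rw [repMap_eq hj hrep hp]
  exact hp.mem_centralInvariants hj

theorem repMap_end_apply (s : Module.End (SmashEnv k H A) M) (a : A) :
    repMap hj hrep (s (j a)) = inclAlg (k := k) (H := H) a * repMap hj hrep (s (j 1)) := by
  rw [← repMap_left_smul, ← map_smul, ← map_smul, SmashEnv.left_smul, mul_one]

/-- If [L_γ] = 0, then L_γ vanishes on its whole domain by `map_eq_of_mk_eq`, so a faithful ideal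
annihilates γ. -/
theorem repMap_injective
    (hz : ∀ (I : HIdeal H A), I.Faithful → ∀ γ : M,
      (∀ x ∈ I.toSubmodule, right k H A x • γ = 0) → γ = 0) :
    Function.Injective (repMap hj hrep) := by
  refine (injective_iff_map_eq_zero _).2 fun γ hγ => ?_
  obtain ⟨p, hp⟩ := hrep γ
  rw [repMap_eq hj hrep hp] at hγ
  refine hz p.dom p.faithful γ fun x hx => ?_
  have e := map_eq_of_mk_eq (k := k) (g := PartialHom.left H 0) hγ hx trivial
  have e' : p.map ⟨x, hx⟩ = 0 := e.trans (zero_mul x)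
  rw [← hp ⟨x, hx⟩, e', map_zero]

end PartialHom
-- The self-injective hull of a module and its endomorphisms
section SelfInjectiveHull

variable {R M E : Type*} [Ring R] [AddCommGroup M] [Module R M] [AddCommGroup E] [Module R E]
  {i : M →ₗ[R] E}

/-- The self-injective hull is a fully invariant submodule. -/
theorem selfInjectiveHull_le_comap (θ : E →ₗ[R] E) :
    selfInjectiveHull R M E ≤ (selfInjectiveHull R M E).comap θ := by
  refine iSup_le fun f => ?_
  rintro _ ⟨x, rfl⟩
  exact (le_iSup (fun f : M →ₗ[R] E => LinearMap.range f) (θ ∘ₗ f)) ⟨x, rfl⟩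

/-- P embeds N / ker P in E, and Q factors through this quotient. Injectivity extends the factor to
an endomorphism of E, which preserves the hull. This is the source of every endomorphism with
prescribed values below. -/
theorem exists_end_comp_eq (hE : Module.Baer R E) {N : Type*} [AddCommGroup N] [Module R N]
    (P Q : N →ₗ[R] selfInjectiveHull R M E) (h : LinearMap.ker P ≤ LinearMap.ker Q) :
    ∃ s : Module.End R (selfInjectiveHull R M E), ∀ x, s (P x) = Q x := by
  obtain ⟨θ, hθ⟩ := hE.extension_property
    ((selfInjectiveHull R M E).subtype ∘ₗ (LinearMap.ker P).liftQ P le_rfl)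
    (Subtype.val_injective.comp (LinearMap.ker_eq_bot.1 (Submodule.ker_liftQ_eq_bot' _ _ rfl)))
    ((selfInjectiveHull R M E).subtype ∘ₗ (LinearMap.ker P).liftQ Q h)
  exact ⟨θ.restrict fun x hx => selfInjectiveHull_le_comap θ hx, fun x =>
    Subtype.ext (LinearMap.congr_fun hθ (Submodule.Quotient.mk x))⟩

theorem toSelfInjectiveHull_injective (hi : Function.Injective i) :
    Function.Injective (toSelfInjectiveHull i) := fun _ _ h => hi (congrArg Subtype.val h)

/-- Every f : M → E agrees on M with an endomorphism s of the hull, so the elements f(a), which span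
the hull, have the form s(a). -/
theorem selfInjectiveHull_induction (hi : Function.Injective i) (hE : Module.Baer R E)
    {P : selfInjectiveHull R M E → Prop}
    (h0 : P 0) (hadd : ∀ x y, P x → P y → P (x + y))
    (happ : ∀ (s : Module.End R (selfInjectiveHull R M E)) (a : M),
      P (s (toSelfInjectiveHull i a))) (x : selfInjectiveHull R M E) : P x := by
  have key : ∀ y (hy : y ∈ selfInjectiveHull R M E), P ⟨y, hy⟩ := by
    intro y hy
    refine Submodule.iSup_induction' (p := fun f : M →ₗ[R] E => LinearMap.range f)
      (motive := fun y hy => P ⟨y, hy⟩) ?_ h0 (fun x y hx hy => hadd ⟨x, hx⟩ ⟨y, hy⟩) hy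
    rintro f _ ⟨a, rfl⟩
    obtain ⟨s, hs⟩ := exists_end_comp_eq hE (toSelfInjectiveHull i)
      (toSelfInjectiveHull f) (by
        rw [LinearMap.ker_eq_bot.2 (toSelfInjectiveHull_injective hi)]
        exact bot_le)
    have := happ s a
    rw [hs a] at this
    exact this
  exact key x.1 x.2

theorem selfInjectiveHull_exists_sum (hi : Function.Injective i) (hE : Module.Baer R E)
    (x : selfInjectiveHull R M E) :
    ∃ (n : ℕ) (a : Fin n → M) (s : Fin n → Module.End R (selfInjectiveHull R M E)),
      x = ∑ j, s j (toSelfInjectiveHull i (a j)) := by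
  refine selfInjectiveHull_induction hi hE (P := fun x => ∃ (n : ℕ) (a : Fin n → M)
    (s : Fin n → Module.End R (selfInjectiveHull R M E)),
      x = ∑ j, s j (toSelfInjectiveHull i (a j))) ⟨0, Fin.elim0, Fin.elim0, by simp⟩ ?_ ?_ x
  · rintro _ _ ⟨m, a, s, rfl⟩ ⟨n, b, t, rfl⟩
    exact ⟨m + n, Fin.append a b, Fin.append s t, by simp [Fin.sum_univ_add]⟩
  · exact fun s a => ⟨1, fun _ => a, fun _ => s, by simp⟩

end SelfInjectiveHull

/-- In a von Neumann regular ring all of whose elements commute, any finite subset of an ideal has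
a common unit in the ideal. -/
theorem IsVonNeumannRegular.exists_mul_eq {C : Type*} [Ring C] (hC : IsVonNeumannRegular C)
    (hcomm : ∀ x y : C, x * y = y * x) (J : Ideal C) (S : Finset J) :
    ∃ e : J, ∀ z ∈ S, z.1 * e.1 = z.1 := by
  classical
  induction S using Finset.induction_on with
  | empty => exact ⟨0, by simp⟩
  | insert z S _ ih =>
    obtain ⟨e, he⟩ := ih
    obtain ⟨y, hy⟩ := hC z.1
    -- The new element e' is chosen with 1 − e' = (1 − y z)(1 − e), so it is a unit for z and for
    -- all elements that e already fixes; each of its terms lies in J.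
    refine ⟨e + y • z - y • (z.1 • e), fun x hx => ?_⟩
    have hzy : z.1 * (y * z.1) = z.1 := by rw [← mul_assoc, ← hy]
    change x.1 * (e.1 + y * z.1 - y * (z.1 * e.1)) = x.1
    rcases Finset.mem_insert.1 hx with rfl | hx
    · rw [mul_sub, mul_add, hzy, ← mul_assoc y, ← mul_assoc x.1, hzy, add_sub_cancel_left]
    · rw [mul_sub, mul_add, he x hx, ← mul_assoc y, hcomm (y * z.1) e.1, ← mul_assoc x.1 e.1,
        he x hx, add_sub_cancel_right]

/-! ### The endomorphism ring of the hull: regularity and self-injectivity -/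

section CentralClosure

open SmashEnv PartialHom

variable {k : Type u} {H : Type v} {A : Type w} [CommRing k] [Ring H] [HopfAlgebra k H] [Ring A]
  [Algebra k A] [Module H A] [IsScalarTower k H A] [HModuleAlgebra k H A]
  {E : Type*} [AddCommGroup E] [Module k E] [Module (SmashEnv k H A) E]
  [IsScalarTower k (SmashEnv k H A) E] {i : A →ₗ[SmashEnv k H A] E}

/-- `i : A → E` is an injective hull and `A` is such that essential `H`-stable ideals are
faithful. -/
structure IsFaithfulHull (i : A →ₗ[SmashEnv k H A] E) : Prop where
  semiprime : IsHSemiprime H A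
  faithful : ∀ U : Submodule (SmashEnv k H A) A, U.IsEssential → (toHIdeal U).Faithful
  injective : Function.Injective i
  essential : (LinearMap.range i).IsEssential
  baer : Module.Baer (SmashEnv k H A) E

/-- The ideal `I_s = s⁻¹(A) ∩ A` of an endomorphism `s` of the self-injective hull. -/
noncomputable def endDomain (i : A →ₗ[SmashEnv k H A] E)
    (s : Module.End (SmashEnv k H A) (selfInjectiveHull (SmashEnv k H A) A E)) :
    Submodule (SmashEnv k H A) A :=
  (LinearMap.range i).comap (Submodule.subtype _ ∘ₗ s ∘ₗ toSelfInjectiveHull i)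

theorem mem_endDomain
    {s : Module.End (SmashEnv k H A) (selfInjectiveHull (SmashEnv k H A) A E)} {y : A} :
    y ∈ endDomain i s ↔ ∃ b, s (toSelfInjectiveHull i y) = toSelfInjectiveHull i b :=
  ⟨fun ⟨b, hb⟩ => ⟨b, Subtype.ext hb.symm⟩, fun ⟨b, hb⟩ => ⟨b, (congrArg Subtype.val hb).symm⟩⟩

namespace IsFaithfulHull

theorem hull_injective (hi : IsFaithfulHull i) : Function.Injective (toSelfInjectiveHull i) :=
  toSelfInjectiveHull_injective hi.injective

theorem eq_zero_of_right_smul (hi : IsFaithfulHull i) (I : HIdeal H A) (hI : I.Faithful)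
    (γ : selfInjectiveHull (SmashEnv k H A) A E)
    (h : ∀ x ∈ I.toSubmodule, right k H A x • γ = 0) : γ = 0 :=
  Subtype.ext (HIdeal.eq_zero_of_right_smul i hi.injective hi.essential hI
    fun x hx => congrArg Subtype.val (h x hx))

theorem isEssential_endDomain (hi : IsFaithfulHull i)
    (s : Module.End (SmashEnv k H A) (selfInjectiveHull (SmashEnv k H A) A E)) :
    (endDomain i s).IsEssential := hi.essential.comap _

/-- For x in U, (f(a) − g(a))x = (f − g)(a x) = 0, and a faithful ideal annihilates no nonzero
element of the hull. -/
theorem hom_ext (hi : IsFaithfulHull i)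
    {f g : A →ₗ[SmashEnv k H A] selfInjectiveHull (SmashEnv k H A) A E}
    {U : Submodule (SmashEnv k H A) A} (hU : U.IsEssential) (h : U ≤ LinearMap.eqLocus f g) :
    f = g := by
  ext1 a
  rw [← sub_eq_zero]
  refine hi.eq_zero_of_right_smul (toHIdeal U) (hi.faithful U hU) _ fun x hx => ?_
  rw [smul_sub, ← map_smul, ← map_smul, right_smul, sub_eq_zero]
  exact h ((toHIdeal U).mul_left a hx)

/-- Endomorphisms of the self-injective hull that agree on an essential ideal of `A` are equal. -/
theorem end_ext (hi : IsFaithfulHull i)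
    {s t : Module.End (SmashEnv k H A) (selfInjectiveHull (SmashEnv k H A) A E)}
    {U : Submodule (SmashEnv k H A) A} (hU : U.IsEssential)
    (h : U ≤ LinearMap.eqLocus (s ∘ₗ toSelfInjectiveHull i) (t ∘ₗ toSelfInjectiveHull i)) :
    s = t := by
  have h1 := hi.hom_ext hU h
  ext1 γ
  refine selfInjectiveHull_induction hi.injective hi.baer (P := fun γ => s γ = t γ) ?_ ?_ ?_ γ
  · rw [map_zero, map_zero]
  · intro x y hx hy
    rw [map_add, map_add, hx, hy]
  · intro u a
    -- For y in the essential ideal `endDomain i u` the element u(y) lies in A, where s and t are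
    -- already known to agree. So `hom_ext` applies a second time, to s ∘ u and t ∘ u.
    refine LinearMap.congr_fun (f := s ∘ₗ u ∘ₗ toSelfInjectiveHull i)
      (g := t ∘ₗ u ∘ₗ toSelfInjectiveHull i) (hi.hom_ext (hi.isEssential_endDomain u) ?_) a
    intro y hy
    obtain ⟨b, hb⟩ := mem_endDomain.1 hy
    change s (u (toSelfInjectiveHull i y)) = t (u (toSelfInjectiveHull i y))
    rw [hb]
    exact LinearMap.congr_fun h1 b

/-- Left multiplication by s(1) is s on A, so it sends I_s into A. The ideal I_s is the preimage of
an essential submodule, hence essential and therefore faithful. -/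
theorem end_represents (hi : IsFaithfulHull i)
    (s : Module.End (SmashEnv k H A) (selfInjectiveHull (SmashEnv k H A) A E)) :
    ∃ p : PartialHom H A, p.dom = toHIdeal (endDomain i s) ∧
      Represents (toSelfInjectiveHull i) (s (toSelfInjectiveHull i 1)) p :=
  ⟨_, rfl, ofElement_represents hi.hull_injective
    (hi.faithful _ (hi.isEssential_endDomain s)) fun y hy => by
      obtain ⟨b, hb⟩ := mem_endDomain.1 hy
      exact ⟨b, by rw [← hb, ← map_smul, ← map_smul, right_smul, one_mul]⟩⟩

theorem exists_represents (hi : IsFaithfulHull i)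
    (γ : selfInjectiveHull (SmashEnv k H A) A E) :
    ∃ p, Represents (toSelfInjectiveHull i) γ p := by
  refine selfInjectiveHull_induction hi.injective hi.baer
    (P := fun γ => ∃ p, Represents (toSelfInjectiveHull i) γ p) ?_ ?_ ?_ γ
  · exact ⟨PartialHom.left H 0, by
      simpa using Represents.left (toSelfInjectiveHull i) (0 : A)⟩
  · rintro x y ⟨p, hp⟩ ⟨q, hq⟩
    exact ⟨_, hp.add hq⟩
  · intro s a
    obtain ⟨p, -, hp⟩ := hi.end_represents s
    refine ⟨(PartialHom.left H a).mul k p, ?_⟩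
    have := hp.left_smul a
    rwa [← map_smul, ← map_smul, SmashEnv.left_smul, mul_one] at this

/-- The endomorphism ring of the self-injective hull is von Neumann regular. -/
theorem end_regular (hi : IsFaithfulHull i)
    (s : Module.End (SmashEnv k H A) (selfInjectiveHull (SmashEnv k H A) A E)) :
    ∃ t, s = s * t * s := by
  let K : HIdeal H A := toHIdeal (LinearMap.ker (s ∘ₗ toSelfInjectiveHull i))
  -- K is the kernel of s on A and meets its left annihilator trivially, so s is injective on that
  -- annihilator and some t inverts it there.
  obtain ⟨t, ht⟩ := exists_end_comp_eq hi.baer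
    (s ∘ₗ toSelfInjectiveHull i ∘ₗ (leftAnn k A K).subtype)
    (toSelfInjectiveHull i ∘ₗ (leftAnn k A K).subtype) (by
      intro x hx
      have : x.1 ∈ ofHIdeal k K ⊓ leftAnn k A K := ⟨hx, x.2⟩
      rw [HIdeal.ofHIdeal_inf_leftAnn hi.semiprime, Submodule.mem_bot] at this
      rw [LinearMap.mem_ker, LinearMap.comp_apply, Submodule.subtype_apply, this, map_zero])
  -- On K both s and s t s vanish, and on the annihilator t s is the identity.
  refine ⟨t, hi.end_ext (HIdeal.isEssential_sup_leftAnn (k := k) K) (sup_le ?_ ?_)⟩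
  · intro x hx
    have hx' : s (toSelfInjectiveHull i x) = 0 := hx
    change s (toSelfInjectiveHull i x) = s (t (s (toSelfInjectiveHull i x)))
    rw [hx', map_zero, map_zero]
  · intro x hx
    exact congrArg s (ht ⟨x, hx⟩).symm

/-- A commutative von Neumann regular ring isomorphic to the endomorphism ring of the self-injective
hull is self-injective. -/
theorem injective_of_ringEquiv (hi : IsFaithfulHull i) {Z : Type*} [Ring Z]
    (hcomm : ∀ x y : Z, x * y = y * x) (hreg : IsVonNeumannRegular Z)
    (Ψ : Module.End (SmashEnv k H A) (selfInjectiveHull (SmashEnv k H A) A E) ≃+* Z) :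
    Module.Injective Z Z := by
  classical
  refine Module.Baer.injective fun J φ => ?_
  -- With ring elements read as endomorphisms, `P` and `Q` send (a_z) to Σ z(a_z) and Σ φ(z)(a_z).
  -- An endomorphism t with t P = Q satisfies t z = φ(z), so multiplication by t extends φ.
  let P : (J →₀ A) →ₗ[SmashEnv k H A] selfInjectiveHull (SmashEnv k H A) A E :=
    Finsupp.lsum ℕ fun z : J => Ψ.symm z.1 ∘ₗ toSelfInjectiveHull i
  let Q : (J →₀ A) →ₗ[SmashEnv k H A] selfInjectiveHull (SmashEnv k H A) A E :=
    Finsupp.lsum ℕ fun z : J => Ψ.symm (φ z) ∘ₗ toSelfInjectiveHull i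
  have hP : ∀ x, P x = x.sum fun z a => Ψ.symm z.1 (toSelfInjectiveHull i a) := fun x => rfl
  have hQ : ∀ x, Q x = x.sum fun z a => Ψ.symm (φ z) (toSelfInjectiveHull i a) := fun x => rfl
  obtain ⟨t, ht⟩ := exists_end_comp_eq hi.baer P Q (by
    intro x hx
    -- A common unit e in J for the support of x gives φ(z) = φ(z e) = φ(e)z there. Hence Q(x) =
    -- φ(e)(P(x)), and the kernel of P lies in that of Q.
    obtain ⟨e, he⟩ := hreg.exists_mul_eq hcomm J x.support
    have hφ : ∀ z ∈ x.support, Ψ.symm (φ z) = Ψ.symm (φ e) * Ψ.symm z.1 := fun z hz => by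
      have : z = z.1 • e := Subtype.ext (he z hz).symm
      rw [← map_mul, hcomm, ← smul_eq_mul, ← map_smul, ← this]
    have : Q x = Ψ.symm (φ e) (P x) := by
      rw [hQ, hP, Finsupp.sum, Finsupp.sum, map_sum]
      exact Finset.sum_congr rfl fun z hz => by rw [hφ z hz, Module.End.mul_apply]
    rw [LinearMap.mem_ker, this, LinearMap.mem_ker.1 hx, map_zero])
  refine ⟨LinearMap.toSpanSingleton Z Z (Ψ t), fun z hz => ?_⟩
  have e : t * Ψ.symm z = Ψ.symm (φ ⟨z, hz⟩) := by
    refine hi.end_ext Submodule.isEssential_top fun a _ => ?_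
    have := ht (Finsupp.single ⟨z, hz⟩ a)
    rwa [hP, hQ, Finsupp.sum_single_index (by rw [map_zero, map_zero]),
      Finsupp.sum_single_index (by rw [map_zero, map_zero])] at this
  have e' := congrArg Ψ e
  rw [map_mul, Ψ.apply_symm_apply, Ψ.apply_symm_apply] at e'
  rw [LinearMap.toSpanSingleton_apply, smul_eq_mul, hcomm, e']

/-! ### The embedding of the hull in the Martindale quotient ring -/

/-- The embedding of the self-injective hull in the Martindale quotient ring. -/
noncomputable def toMartindale (hi : IsFaithfulHull i) :
    selfInjectiveHull (SmashEnv k H A) A E →ₗ[k] MartindaleQuotient k H A :=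
  repMap hi.hull_injective hi.exists_represents

theorem toMartindale_eq (hi : IsFaithfulHull i)
    {γ : selfInjectiveHull (SmashEnv k H A) A E} {p : PartialHom H A}
    (hp : Represents (toSelfInjectiveHull i) γ p) :
    hi.toMartindale γ = MartindaleQuotient.mk k p :=
  repMap_eq _ _ hp

theorem toMartindale_injective (hi : IsFaithfulHull i) : Function.Injective hi.toMartindale :=
  repMap_injective _ _ hi.eq_zero_of_right_smul

/-- An invariant element of the Martindale quotient ring that commutes with `A` comes from an
endomorphism of the self-injective hull. -/
theorem exists_end (hi : IsFaithfulHull i) {q : MartindaleQuotient k H A}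
    (hq : ∀ a : A, q * MartindaleQuotient.inclAlg a = MartindaleQuotient.inclAlg a * q)
    (hq' : ∀ h : H, h • q = counit (R := k) h • q) :
    ∃ s : Module.End (SmashEnv k H A) (selfInjectiveHull (SmashEnv k H A) A E),
      hi.toMartindale (s (toSelfInjectiveHull i 1)) = q := by
  obtain ⟨f, rfl⟩ := MartindaleQuotient.mk_surjective q
  -- Commuting with A makes f left linear and invariance makes it H-linear, so f is linear over the
  -- smash product.
  let F : ofHIdeal k f.dom →ₗ[SmashEnv k H A] A :=
    { toFun := fun x => f.map ⟨x.1, x.2⟩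
      map_add' := fun x y => f.map.map_add ⟨x.1, x.2⟩ ⟨y.1, y.2⟩
      map_smul' := map_smul_of_map_mk (k := k) (H := H) (A := A) (M := A)
        (N := ofHIdeal k f.dom) (f.map.toAddMonoidHom : ofHIdeal k f.dom →+ A)
        (fun a x => by
          have e := MartindaleQuotient.map_mul_left_of_commute (k := k) (f := f) hq a x.2
          rw [SmashEnv.left_smul]
          refine Eq.trans ?_ e
          exact congrArg f.map (Subtype.ext (SmashEnv.left_smul (k := k) (H := H) a x.1)))
        (fun a x => by
          rw [SmashEnv.right_smul]
          refine Eq.trans ?_ (PartialHom.map_mul_right f x a)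
          exact congrArg f.map (Subtype.ext (SmashEnv.right_smul (k := k) (H := H) a x.1)))
        (fun h x => by
          have e := MartindaleQuotient.map_hsmul_of_invariant (k := k) (f := f) hq' h x.2
          rw [hopf_smul]
          refine Eq.trans ?_ e
          exact congrArg f.map (Subtype.ext (hopf_smul (k := k) h x.1))) }
  -- An endomorphism s that restricts to f on its domain satisfies s(1)y = s(y) = f(y) there, so f
  -- represents s(1).
  obtain ⟨s, hs⟩ := exists_end_comp_eq hi.baer
    (toSelfInjectiveHull i ∘ₗ (ofHIdeal k f.dom).subtype) (toSelfInjectiveHull i ∘ₗ F) (by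
      rw [(LinearMap.ker_eq_bot (f := toSelfInjectiveHull i ∘ₗ (ofHIdeal k f.dom).subtype)).2
        (hi.hull_injective.comp (ofHIdeal k f.dom).injective_subtype)]
      exact bot_le)
  refine ⟨s, repMap_eq _ _ fun y => ?_⟩
  rw [← map_smul, ← map_smul, SmashEnv.right_smul, one_mul]
  exact (hs y).symm

/-- The isomorphism of the endomorphism ring of the self-injective hull with the ring of central
invariants of the Martindale quotient ring. -/
noncomputable def endEquiv (hi : IsFaithfulHull i) :
    Module.End (SmashEnv k H A) (selfInjectiveHull (SmashEnv k H A) A E) ≃ₐ[k]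
      centralInvariants k H (MartindaleQuotient k H A) :=
  AlgEquiv.ofBijective
    (AlgHom.ofLinearMap
      { toFun := fun s => ⟨hi.toMartindale (s (toSelfInjectiveHull i 1)), repMap_end_mem _ _ s⟩
        map_add' := fun s t => Subtype.ext (map_add hi.toMartindale _ _)
        map_smul' := fun c s => Subtype.ext (map_smul hi.toMartindale c _) }
      (Subtype.ext (repMap_self _ _ 1))
      fun s t => Subtype.ext (repMap_end_mul _ _ s t))
    -- If s(1) = t(1), left multiplication by a gives s(a) = t(a), and endomorphisms that agree on A
    -- are equal.
    ⟨fun s t h => by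
        have h1 := hi.toMartindale_injective (congrArg Subtype.val h)
        refine hi.end_ext Submodule.isEssential_top fun a _ => ?_
        have h2 := congrArg (fun γ => SmashEnv.mk (k := k) a 1 (1 : H) • γ) h1
        simp only [← map_smul, SmashEnv.left_smul, mul_one] at h2
        exact h2,
      fun z => by
        obtain ⟨s, hs⟩ := hi.exists_end (fun a => z.2.1 _) z.2.2
        exact ⟨s, Subtype.ext hs⟩⟩

theorem endEquiv_apply (hi : IsFaithfulHull i)
    (s : Module.End (SmashEnv k H A) (selfInjectiveHull (SmashEnv k H A) A E)) :
    (hi.endEquiv s : MartindaleQuotient k H A) =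
      hi.toMartindale (s (toSelfInjectiveHull i 1)) := rfl

theorem toMartindale_end_apply (hi : IsFaithfulHull i)
    (s : Module.End (SmashEnv k H A) (selfInjectiveHull (SmashEnv k H A) A E)) (a : A) :
    hi.toMartindale (s (toSelfInjectiveHull i a)) =
      MartindaleQuotient.inclAlg a * (hi.endEquiv s : MartindaleQuotient k H A) :=
  repMap_end_apply _ _ s a

theorem toMartindale_self (hi : IsFaithfulHull i) (a : A) :
    hi.toMartindale (toSelfInjectiveHull i a) = MartindaleQuotient.inclAlg a :=
  repMap_self _ _ a

theorem toMartindale_right_smul (hi : IsFaithfulHull i)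
    (γ : selfInjectiveHull (SmashEnv k H A) A E) (a : A) :
    hi.toMartindale (right k H A a • γ) = hi.toMartindale γ * MartindaleQuotient.inclAlg a :=
  repMap_right_smul _ _ γ a

theorem toMartindale_hopf_smul (hi : IsFaithfulHull i)
    (γ : selfInjectiveHull (SmashEnv k H A) A E) (h : H) :
    hi.toMartindale (hopf k H A h • γ) = h • hi.toMartindale γ :=
  repMap_hopf_smul _ _ γ h

theorem isVonNeumannRegular_centralInvariants (hi : IsFaithfulHull i) :
    IsVonNeumannRegular (centralInvariants k H (MartindaleQuotient k H A)) := fun z => by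
  obtain ⟨t, ht⟩ := hi.end_regular (hi.endEquiv.symm z)
  refine ⟨hi.endEquiv t, ?_⟩
  have := congrArg hi.endEquiv ht
  rwa [map_mul, map_mul, AlgEquiv.apply_symm_apply] at this

theorem injective_centralInvariants (hi : IsFaithfulHull i) :
    Module.Injective (centralInvariants k H (MartindaleQuotient k H A))
      (centralInvariants k H (MartindaleQuotient k H A)) :=
  hi.injective_of_ringEquiv (fun x y => Subtype.ext (x.2.1 y))
    hi.isVonNeumannRegular_centralInvariants hi.endEquiv.toRingEquiv

end IsFaithfulHull

end CentralClosure
-- H-stable subalgebras of a module algebra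
section StableSubalgebra

variable {k : Type u} {H : Type v} {Q : Type w} [CommRing k] [Ring H] [HopfAlgebra k H] [Ring Q]
  [Algebra k Q] [Module H Q] [IsScalarTower k H Q]

/-- An `H`-stable subalgebra of an `H`-module algebra, lifted to the universe of `H`. -/
def StableSubalgebra (S : Subalgebra k Q) (_hS : ∀ (h : H), ∀ x ∈ S, h • x ∈ S) :
    Type (max v w) := ULift.{v} S

namespace StableSubalgebra

variable {S : Subalgebra k Q} {hS : ∀ (h : H), ∀ x ∈ S, h • x ∈ S}

instance : Ring (StableSubalgebra S hS) := inferInstanceAs (Ring (ULift.{v} S))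

instance : Algebra k (StableSubalgebra S hS) := inferInstanceAs (Algebra k (ULift.{v} S))

/-- The inclusion of an `H`-stable subalgebra. -/
def val : StableSubalgebra S hS →ₐ[k] Q :=
  S.val.comp (ULift.algEquiv : ULift.{v} S ≃ₐ[k] S).toAlgHom

theorem val_injective : Function.Injective (val : StableSubalgebra S hS →ₐ[k] Q) :=
  Subtype.val_injective.comp ULift.down_injective

/-- An element of the subalgebra. -/
def of (x : Q) (hx : x ∈ S) : StableSubalgebra S hS := ULift.up ⟨x, hx⟩

theorem val_mem (x : StableSubalgebra S hS) : val x ∈ S := x.down.2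

theorem range_val : (val : StableSubalgebra S hS →ₐ[k] Q).range = S :=
  le_antisymm (by rintro _ ⟨x, rfl⟩; exact val_mem x) fun x hx => ⟨of x hx, rfl⟩

instance : SMul H (StableSubalgebra S hS) := ⟨fun h x => of (h • val x) (hS h _ (val_mem x))⟩

theorem val_hsmul (h : H) (x : StableSubalgebra S hS) : val (h • x) = h • val x := rfl

instance : Module H (StableSubalgebra S hS) where
  one_smul x := val_injective (one_smul H (val x))
  mul_smul g h x := val_injective (mul_smul g h (val x))
  smul_zero h := val_injective (by rw [val_hsmul, map_zero, smul_zero])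
  smul_add h x y := val_injective (by
    rw [val_hsmul, map_add, smul_add, map_add, val_hsmul, val_hsmul])
  add_smul g h x := val_injective (by
    rw [val_hsmul, add_smul, map_add, val_hsmul, val_hsmul])
  zero_smul x := val_injective (by rw [val_hsmul, zero_smul, map_zero])

instance : IsScalarTower k H (StableSubalgebra S hS) where
  smul_assoc c h x := val_injective (by
    rw [val_hsmul, smul_assoc, map_smul, val_hsmul])

instance [HModuleAlgebra k H Q] : HModuleAlgebra k H (StableSubalgebra S hS) where
  smul_one h := val_injective (by
    rw [val_hsmul, map_one, HModuleAlgebra.smul_one (k := k), AlgHom.commutes])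
  smul_mul h x y := val_injective (by
    rw [val_hsmul, map_mul, HModuleAlgebra.smul_mul (k := k)]
    induction (comul (R := k) h) using TensorProduct.induction_on with
    | zero => simp
    | add s t hs ht => simp only [map_add, hs, ht]
    | tmul p q =>
      change (p • val x) * (q • val y) = val ((p • x) * (q • y))
      rw [map_mul, val_hsmul, val_hsmul])

end StableSubalgebra

end StableSubalgebra

/-! ### The algebra structure of the hull -/

namespace IsFaithfulHull

open SmashEnv PartialHom

variable {k : Type u} {H : Type v} {A : Type w} [CommRing k] [Ring H] [HopfAlgebra k H] [Ring A]
  [Algebra k A] [Module H A] [IsScalarTower k H A] [HModuleAlgebra k H A]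
  {E : Type*} [AddCommGroup E] [Module k E] [Module (SmashEnv k H A) E]
  [IsScalarTower k (SmashEnv k H A) E] {i : A →ₗ[SmashEnv k H A] E}

/-- In Q₀ the classes of s and t are central, so (a s)(b t) = (a b)(s t). The product required on
the hull is thus that of Q₀, and associativity and distributivity are inherited. -/
theorem toMartindale_mul_end (hi : IsFaithfulHull i)
    (s t : Module.End (SmashEnv k H A) (selfInjectiveHull (SmashEnv k H A) A E)) (a b : A) :
    hi.toMartindale (s (toSelfInjectiveHull i a)) * hi.toMartindale (t (toSelfInjectiveHull i b)) =
      hi.toMartindale ((s * t) (toSelfInjectiveHull i (a * b))) := by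
  rw [toMartindale_end_apply, toMartindale_end_apply, toMartindale_end_apply, map_mul, map_mul,
    mul_assoc, ← mul_assoc (hi.endEquiv s : MartindaleQuotient k H A), (hi.endEquiv s).2.1,
    MulMemClass.coe_mul, mul_assoc, mul_assoc]

/-- The image of the self-injective hull in the Martindale quotient ring. -/
noncomputable def image (hi : IsFaithfulHull i) : Subalgebra k (MartindaleQuotient k H A) where
  carrier := Set.range hi.toMartindale
  add_mem' := by
    rintro _ _ ⟨x, rfl⟩ ⟨y, rfl⟩
    exact ⟨x + y, map_add _ x y⟩
  mul_mem' := by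
    rintro _ _ ⟨x, rfl⟩ ⟨y, rfl⟩
    refine selfInjectiveHull_induction hi.injective hi.baer
      (P := fun x => hi.toMartindale x * hi.toMartindale y ∈ Set.range hi.toMartindale) ?_ ?_ ?_ x
    · exact ⟨0, by rw [map_zero, zero_mul]⟩
    · rintro x x' ⟨z, hz⟩ ⟨z', hz'⟩
      exact ⟨z + z', by rw [map_add, map_add, add_mul, hz, hz']⟩
    · intro s a
      refine selfInjectiveHull_induction hi.injective hi.baer
        (P := fun y => hi.toMartindale (s (toSelfInjectiveHull i a)) * hi.toMartindale y ∈
          Set.range hi.toMartindale) ?_ ?_ ?_ y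
      · exact ⟨0, by rw [map_zero, mul_zero]⟩
      · rintro y y' ⟨z, hz⟩ ⟨z', hz'⟩
        exact ⟨z + z', by rw [map_add, map_add, mul_add, hz, hz']⟩
      · exact fun t b => ⟨_, (hi.toMartindale_mul_end s t a b).symm⟩
  algebraMap_mem' c := ⟨toSelfInjectiveHull i (algebraMap k A c), by
    rw [toMartindale_self, AlgHom.commutes]⟩

theorem mem_image (hi : IsFaithfulHull i) (x : selfInjectiveHull (SmashEnv k H A) A E) :
    hi.toMartindale x ∈ hi.image := ⟨x, rfl⟩

theorem hsmul_mem_image (hi : IsFaithfulHull i) (h : H) :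
    ∀ x ∈ hi.image, h • x ∈ hi.image := by
  rintro _ ⟨x, rfl⟩
  exact ⟨_, hi.toMartindale_hopf_smul x h⟩

theorem image_eq_adjoin (hi : IsFaithfulHull i) : hi.image = Algebra.adjoin k
    (Set.range (MartindaleQuotient.inclAlg : A →ₐ[k] MartindaleQuotient k H A) ∪
      (centralInvariants k H (MartindaleQuotient k H A) : Set (MartindaleQuotient k H A))) := by
  refine le_antisymm ?_ (Algebra.adjoin_le ?_)
  · rintro _ ⟨x, rfl⟩
    refine selfInjectiveHull_induction hi.injective hi.baer
      (P := fun x => hi.toMartindale x ∈ Algebra.adjoin k _) ?_ ?_ ?_ x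
    · rw [map_zero]
      exact zero_mem _
    · intro x y hx hy
      rw [map_add]
      exact add_mem hx hy
    · intro s a
      rw [toMartindale_end_apply]
      exact mul_mem (Algebra.subset_adjoin (Or.inl ⟨a, rfl⟩))
        (Algebra.subset_adjoin (Or.inr (hi.endEquiv s).2))
  · rintro _ (⟨a, rfl⟩ | hz)
    · exact ⟨_, hi.toMartindale_self a⟩
    · obtain ⟨s, hs⟩ := hi.exists_end (fun a => hz.1 _) hz.2
      exact ⟨_, hs⟩

/-- The central closure of `A`. -/
abbrev Closure (hi : IsFaithfulHull i) : Type (max v w) :=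
  StableSubalgebra hi.image hi.hsmul_mem_image

/-- The identification of the self-injective hull with the central closure. -/
noncomputable def closureEquiv (hi : IsFaithfulHull i) :
    selfInjectiveHull (SmashEnv k H A) A E ≃ₗ[k] hi.Closure :=
  LinearEquiv.ofBijective
    { toFun := fun x => StableSubalgebra.of (hi.toMartindale x) (hi.mem_image x)
      map_add' := fun x y => StableSubalgebra.val_injective (by
        rw [map_add StableSubalgebra.val]
        exact map_add hi.toMartindale x y)
      map_smul' := fun c x => StableSubalgebra.val_injective (by
        rw [map_smul StableSubalgebra.val]
        exact map_smul hi.toMartindale c x) }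
    ⟨fun x y h => hi.toMartindale_injective (congrArg StableSubalgebra.val h), fun c => by
      obtain ⟨x, hx⟩ := StableSubalgebra.val_mem c
      exact ⟨x, StableSubalgebra.val_injective hx⟩⟩

theorem val_closureEquiv (hi : IsFaithfulHull i) (x : selfInjectiveHull (SmashEnv k H A) A E) :
    StableSubalgebra.val (hi.closureEquiv x) = hi.toMartindale x := rfl

theorem isCentralClosure (hi : IsFaithfulHull i) : IsCentralClosure i hi.closureEquiv where
  map_one := StableSubalgebra.val_injective (by
    rw [val_closureEquiv, toMartindale_self, map_one, map_one])
  map_mul a b s t := StableSubalgebra.val_injective (by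
    rw [map_mul]
    exact hi.toMartindale_mul_end s t a b)
  map_hsmul h x := StableSubalgebra.val_injective (hi.toMartindale_hopf_smul x h).symm

/-- A priori z commutes only with the closure. But this contains A, and an invariant element
commuting with A comes from an endomorphism, whose class is central in all of Q₀. -/
theorem val_mem_centralInvariants (hi : IsFaithfulHull i) (z : centralInvariants k H hi.Closure) :
    StableSubalgebra.val z.1 ∈ centralInvariants k H (MartindaleQuotient k H A) := by
  obtain ⟨s, hs⟩ := hi.exists_end (q := StableSubalgebra.val z.1)
    (fun a => by
      rw [← toMartindale_self hi, ← val_closureEquiv, ← map_mul, ← map_mul, z.2.1])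
    (fun h => by rw [← StableSubalgebra.val_hsmul, z.2.2, map_smul])
  rw [← hs]
  exact (hi.endEquiv s).2

/-- The isomorphism of the rings of central invariants of the central closure and of the Martindale
quotient ring. -/
noncomputable def invariantsEquiv (hi : IsFaithfulHull i) :
    centralInvariants k H hi.Closure ≃ₐ[k] centralInvariants k H (MartindaleQuotient k H A) :=
  AlgEquiv.ofBijective
    ((StableSubalgebra.val.comp (centralInvariants k H hi.Closure).val).codRestrict _
      hi.val_mem_centralInvariants)
    ⟨fun y z h => by
        have e := congrArg (centralInvariants k H (MartindaleQuotient k H A)).val h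
        exact Subtype.ext (StableSubalgebra.val_injective e),
      fun z => by
        obtain ⟨s, hs⟩ := hi.exists_end (fun a => z.2.1 _) z.2.2
        refine ⟨⟨hi.closureEquiv (s (toSelfInjectiveHull i 1)), ?_, ?_⟩, Subtype.ext hs⟩
        · intro x
          apply StableSubalgebra.val_injective
          rw [map_mul, map_mul, val_closureEquiv, hs, z.2.1]
        · intro h
          apply StableSubalgebra.val_injective
          rw [map_smul StableSubalgebra.val (counit (R := k) h), StableSubalgebra.val_hsmul,
            val_closureEquiv, hs, z.2.2]⟩

theorem invariantsEquiv_apply (hi : IsFaithfulHull i) (z : centralInvariants k H hi.Closure) :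
    (hi.invariantsEquiv z : MartindaleQuotient k H A) = StableSubalgebra.val z.1 := rfl

/-- The isomorphism `f ↦ f(1)` of the endomorphism ring of the self-injective hull with the ring of
central invariants of the central closure. -/
noncomputable def endClosureEquiv (hi : IsFaithfulHull i) :
    Module.End (SmashEnv k H A) (selfInjectiveHull (SmashEnv k H A) A E) ≃ₐ[k]
      centralInvariants k H hi.Closure :=
  hi.endEquiv.trans hi.invariantsEquiv.symm

theorem invariantsEquiv_endClosureEquiv (hi : IsFaithfulHull i)
    (s : Module.End (SmashEnv k H A) (selfInjectiveHull (SmashEnv k H A) A E)) :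
    hi.invariantsEquiv (hi.endClosureEquiv s) = hi.endEquiv s :=
  hi.invariantsEquiv.apply_symm_apply _

theorem val_endClosureEquiv (hi : IsFaithfulHull i)
    (s : Module.End (SmashEnv k H A) (selfInjectiveHull (SmashEnv k H A) A E)) :
    StableSubalgebra.val (hi.endClosureEquiv s).1 =
      (hi.endEquiv s : MartindaleQuotient k H A) := by
  rw [← invariantsEquiv_apply, invariantsEquiv_endClosureEquiv]

theorem endClosureEquiv_apply (hi : IsFaithfulHull i)
    (s : Module.End (SmashEnv k H A) (selfInjectiveHull (SmashEnv k H A) A E)) :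
    (hi.endClosureEquiv s : hi.Closure) = hi.closureEquiv (s (toSelfInjectiveHull i 1)) :=
  StableSubalgebra.val_injective (hi.val_endClosureEquiv s)

theorem closureEquiv_end_apply (hi : IsFaithfulHull i)
    (s : Module.End (SmashEnv k H A) (selfInjectiveHull (SmashEnv k H A) A E)) (a : A) :
    hi.closureEquiv (s (toSelfInjectiveHull i a)) =
      hi.closureEquiv (toSelfInjectiveHull i a) * hi.endClosureEquiv s :=
  StableSubalgebra.val_injective (by
    rw [map_mul, val_endClosureEquiv, val_closureEquiv, val_closureEquiv, toMartindale_end_apply,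
      toMartindale_self])

theorem closureEquiv_sum (hi : IsFaithfulHull i) {n : ℕ} (a : Fin n → A)
    (s : Fin n → Module.End (SmashEnv k H A) (selfInjectiveHull (SmashEnv k H A) A E)) :
    hi.closureEquiv (∑ j, s j (toSelfInjectiveHull i (a j))) =
      ∑ j, hi.closureEquiv (toSelfInjectiveHull i (a j)) * hi.endClosureEquiv (s j) := by
  rw [map_sum]
  exact Finset.sum_congr rfl fun j _ => hi.closureEquiv_end_apply (s j) (a j)

/-- The sum `∑ a_j s_j` is represented by a partial map with domain the intersection of the ideals
`s_j⁻¹(A) ∩ A`. -/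
theorem sum_represents (hi : IsFaithfulHull i) {n : ℕ} (a : Fin n → A)
    (s : Fin n → Module.End (SmashEnv k H A) (selfInjectiveHull (SmashEnv k H A) A E)) :
    ∃ p : PartialHom H A, p.dom = toHIdeal (⨅ j, endDomain i (s j)) ∧
      Represents (toSelfInjectiveHull i) (∑ j, s j (toSelfInjectiveHull i (a j))) p := by
  refine ⟨_, rfl, ofElement_represents hi.hull_injective (hi.faithful _
    (Submodule.IsEssential.iInf fun j => hi.isEssential_endDomain (s j))) fun y hy => ?_⟩
  -- If s_j(y) = b_j lies in A for every j, then left multiplication by Σ a_j s_j sends y to Σ a_j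
  -- b_j.
  choose b hb using fun j => mem_endDomain.1 ((Submodule.mem_iInf _).1 hy j)
  refine ⟨∑ j, a j * b j, ?_⟩
  rw [map_sum, Finset.smul_sum]
  refine Finset.sum_congr rfl fun j _ => ?_
  rw [← map_smul, ← map_smul, SmashEnv.right_smul, ← SmashEnv.left_smul (k := k) (H := H),
    ← SmashEnv.left_smul (k := k) (H := H), map_smul, map_smul, map_smul, hb]

theorem closureEquiv_right_smul (hi : IsFaithfulHull i)
    (γ : selfInjectiveHull (SmashEnv k H A) A E) (y : A) :
    hi.closureEquiv (right k H A y • γ) =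
      hi.closureEquiv γ * hi.closureEquiv (toSelfInjectiveHull i y) :=
  StableSubalgebra.val_injective (by
    rw [map_mul, val_closureEquiv, val_closureEquiv, val_closureEquiv, toMartindale_right_smul,
      toMartindale_self])

/-- The element x = s(1) is central, so x y = y x = s(y). This identifies I_x, defined by
multiplication in the closure, with I_s. -/
theorem exists_mul_eq_iff (hi : IsFaithfulHull i)
    (s : Module.End (SmashEnv k H A) (selfInjectiveHull (SmashEnv k H A) A E)) (y : A) :
    (∃ b : A, (hi.endClosureEquiv s : hi.Closure) * hi.closureEquiv (toSelfInjectiveHull i y) =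
      hi.closureEquiv (toSelfInjectiveHull i b)) ↔ y ∈ endDomain i s := by
  rw [mem_endDomain]
  refine exists_congr fun b => ?_
  rw [(hi.endClosureEquiv s).2.1, ← closureEquiv_end_apply, hi.closureEquiv.injective.eq_iff]

theorem of_isInjectiveHull {E : Type (max v w)} [AddCommGroup E] [Module k E]
    [Module (SmashEnv k H A) E] [IsScalarTower k (SmashEnv k H A) E] {i : A →ₗ[SmashEnv k H A] E}
    (hA : IsHSemiprime H A)
    (hcase : (∀ a b : A, a * b = b * a) ∨ IsSemiprimeAlgebra A ∨
      Function.Bijective (HopfAlgebra.antipode k : H →ₗ[k] H)) (hi : IsInjectiveHull i) :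
    IsFaithfulHull i where
  semiprime := hA
  faithful _ hU := HIdeal.faithful_of_isEssential hA hcase hU
  injective := hi.injective
  essential := hi.essential
  -- The universe of E is that of the smash product, so injectivity can be tested on its left
  -- ideals.
  baer := Module.Baer.of_injective hi.injective_module

end IsFaithfulHull

/-! ### The main theorem -/

theorem proposition5p5 {k : Type u} {H : Type v} {A : Type w} [CommRing k] [Ring H]
    [HopfAlgebra k H] [Ring A] [Algebra k A] [Module H A] [IsScalarTower k H A]
    [HModuleAlgebra k H A] (hA : IsHSemiprime H A)
    (hcase : (∀ a b : A, a * b = b * a) ∨ IsSemiprimeAlgebra A ∨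
      Function.Bijective (HopfAlgebra.antipode k : H →ₗ[k] H))
    {E : Type (max v w)} [AddCommGroup E] [Module k E] [Module (SmashEnv k H A) E]
    [IsScalarTower k (SmashEnv k H A) E] (i : A →ₗ[SmashEnv k H A] E) (hi : IsInjectiveHull i) :
    -- the central closure `C`, i.e. the self-injective hull with its algebra structure
    ∃ (C : Type (max v w)) (_ : Ring C) (_ : Algebra k C) (_ : Module H C)
      (_ : IsScalarTower k H C) (_ : HModuleAlgebra k H C)
      (e : selfInjectiveHull (SmashEnv k H A) A E ≃ₗ[k] C),
      IsCentralClosure i e ∧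
      ∃ (Ψ : Module.End (SmashEnv k H A) (selfInjectiveHull (SmashEnv k H A) A E) ≃ₐ[k]
            centralInvariants k H C)
        (ψ : centralInvariants k H C ≃ₐ[k] centralInvariants k H (MartindaleQuotient k H A))
        (ψbar : C →ₐ[k] MartindaleQuotient k H A),
        -- the identification of `B`-endomorphisms `f` with elements `f(1)` of `Z(C)^H`
        (∀ f, (Ψ f : C) = e (f (toSelfInjectiveHull i 1))) ∧
        -- `ψ(f) = [f : I_f → A]` with `I_f = f⁻¹(A) ∩ A`
        (∀ f, ∃ p : PartialHom H A,
          (∀ y : A, y ∈ p.dom.toSubmodule ↔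
            ∃ b : A, f (toSelfInjectiveHull i y) = toSelfInjectiveHull i b) ∧
          (∀ y : p.dom.toSubmodule,
            toSelfInjectiveHull i (p.map y) = f (toSelfInjectiveHull i y)) ∧
          (ψ (Ψ f) : MartindaleQuotient k H A) = MartindaleQuotient.mk k p) ∧
        -- `Z(Q₀)^H` is von Neumann regular and self-injective
        IsVonNeumannRegular (centralInvariants k H (MartindaleQuotient k H A)) ∧
        Module.Injective (centralInvariants k H (MartindaleQuotient k H A))
          (centralInvariants k H (MartindaleQuotient k H A)) ∧
        -- `ψbar` is injective, every `γ` is a sum `∑ a_j x_j`, and `ψbar(γ) = [L_γ : I → A]` with `I = ⋂ I_{x_j}`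
        Function.Injective ψbar ∧
        (∀ γ : C, ∃ (n : ℕ) (a : Fin n → A) (x : Fin n → centralInvariants k H C),
          γ = ∑ j, e (toSelfInjectiveHull i (a j)) * x j) ∧
        (∀ (n : ℕ) (a : Fin n → A) (x : Fin n → centralInvariants k H C) (γ : C),
          γ = ∑ j, e (toSelfInjectiveHull i (a j)) * x j →
          ∃ p : PartialHom H A,
            (∀ y : A, y ∈ p.dom.toSubmodule ↔
              ∀ j, ∃ b : A, x j * e (toSelfInjectiveHull i y) = e (toSelfInjectiveHull i b)) ∧
            (∀ y : p.dom.toSubmodule,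
              e (toSelfInjectiveHull i (p.map y)) = γ * e (toSelfInjectiveHull i y)) ∧
            ψbar γ = MartindaleQuotient.mk k p) ∧
        -- the image of `ψbar` is the subalgebra generated by `A` and `Z(Q₀)^H`
        ψbar.range = Algebra.adjoin k
          (Set.range (MartindaleQuotient.inclAlg : A →ₐ[k] MartindaleQuotient k H A) ∪
            (centralInvariants k H (MartindaleQuotient k H A) : Set (MartindaleQuotient k H A))) := by
  have h := IsFaithfulHull.of_isInjectiveHull hA hcase hi
  -- The algebra C is a copy of the image of the hull in Q₀. So ψ̄ is the inclusion and ψ is its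
  -- restriction to central invariants.
  refine ⟨h.Closure, inferInstance, inferInstance, inferInstance, inferInstance, inferInstance,
    h.closureEquiv, h.isCentralClosure, h.endClosureEquiv, h.invariantsEquiv,
    StableSubalgebra.val, h.endClosureEquiv_apply, fun f => ?_,
    h.isVonNeumannRegular_centralInvariants, h.injective_centralInvariants,
    StableSubalgebra.val_injective, fun γ => ?_, ?_, ?_⟩
  · obtain ⟨p, hdom, hp⟩ := h.end_represents f
    refine ⟨p, fun y => ?_, fun y => hp.end_apply y, ?_⟩
    · rw [hdom]
      exact SmashEnv.mem_toHIdeal.trans mem_endDomain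
    · rw [h.invariantsEquiv_endClosureEquiv, h.endEquiv_apply]
      exact h.toMartindale_eq hp
  · obtain ⟨x, rfl⟩ := h.closureEquiv.surjective γ
    obtain ⟨n, a, s, rfl⟩ := selfInjectiveHull_exists_sum h.injective h.baer x
    exact ⟨n, a, fun j => h.endClosureEquiv (s j), h.closureEquiv_sum a s⟩
  · rintro n a x _ rfl
    -- Each x_j is s_j(1) for an endomorphism s_j, so ⋂ I_{x_j} becomes the intersection of the
    -- ideals `endDomain i (s j)`.
    obtain ⟨s, rfl⟩ : ∃ s : Fin n → _, x = fun j => h.endClosureEquiv (s j) :=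
      ⟨fun j => h.endClosureEquiv.symm (x j), by simp⟩
    obtain ⟨p, hdom, hp⟩ := h.sum_represents a s
    rw [← h.closureEquiv_sum a s]
    refine ⟨p, fun y => ?_, fun y => ?_, h.toMartindale_eq hp⟩
    · rw [hdom, SmashEnv.mem_toHIdeal, Submodule.mem_iInf]
      exact forall_congr' fun j => (h.exists_mul_eq_iff (s j) y).symm
    · rw [hp y, h.closureEquiv_right_smul]
  · rw [StableSubalgebra.range_val, h.image_eq_adjoin]
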